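/- Let $S$ be a finite or countably infinite set and let $B=(B(x,y):x,y\in S)$ be an irreducible non-negative matrix with $\sum_y B(x,y)\le 1$ for all $x$. Suppose $B(x,y)=\delta\psi(y)+\tilde B(x,y)$ for $x,y\in S$, where $\delta>0$, $\psi$ is a probability on $S$ and $\tilde B\ge 0$. Let $X=(X_n:n\ge 0)$ be the Markov chain on $S\cup\{\Delta\}$ ($\Delta\notin S$ absorbing) whose transitions from $x\in S$ are made as follows: with probability $\delta$ the next state is distributed according to $\psi$ (a regeneration); with probability $\tilde B(x,y)$ the next state is $y$; with probability $1-\sum_y B(x,y)$ the next state is $\Delta$. Let $T=\inf\{n\ge 0:X_n=\Delta\}$, let $\tau\ge 1$ be the first time at which $X$ is distributed according to $\psi$ by a regeneration (both times may be infinite; $T>\tau$ entails $\tau<\infty$), and let $E_x$ be the expectation for $X_0=x$ and $E_\psi=\sum_x\psi(x)E_x$. Put $$\theta_1=\sup\{\theta\in\mathbb R:E_\psi e^{\theta T}<\infty\},\qquad \theta_2=\sup\{\theta\in\mathbb R:E_\psi e^{\theta (T\wedge\tau)}<\infty\}$$ (as extended real numbers). If $\theta_2>\theta_1$, then there exists a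 real solution $\theta$ of $$E_\psi e^{\theta\tau}I(T>\tau)=1 .$$ For any such $\theta$ put $\lambda_*=e^{-\theta}$ and, for $x,y\in S$, $$u_*(x)=E_xe^{\theta\tau}I(T>\tau),\qquad \eta_*(y)=E_\psi\sum_{j=0}^{\tau-1}e^{\theta j}I(X_j=y,\,T>j).$$ Then: (i) $u_*$ is a positive finite-valued solution of $Bu=\lambda_*u$, and any other positive finite-valued solution is a positive multiple of $u_*$. (ii) $\eta_*$ is a positive finite-valued solution of $\eta B=\lambda_*\eta$, and any other positive finite-valued solution is a positive multiple of $\eta_*$. (iii) $\sum_{w\in S}\eta_*(w)u_*(w)<\infty$. (iv) If $p$ is the period of $B$ (the greatest common divisor of $\{k\ge 1:B^k(z,z)>0\}$, for any $z\in S$), then for all $x,y\in S$, as $n\to\infty$, $$\frac1p\sum_{j=0}^{p-1}\lambda_*^{-pn-j}B^{pn+j}(x,y)\;\to\;\frac{u_*(x)\eta_*(y)}{\sum_{w\in S}\eta_*(w)u_*(w)} .$$ -/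

import Mathlib

open MeasureTheory ProbabilityTheory
open scoped ENNReal NNReal Topology

/-- An infinite (or finite) non-negative sub-stochastic matrix `B` on `S` together with a splitting
`B = δ ψ + B̃`, where `δ > 0`, `ψ` is a probability on `S` and `B̃ ≥ 0`, i.e. `B x y ≥ δ ψ y`
for all `x` and `y`. -/
structure SplitMatrix (S : Type*) where
  /-- the matrix -/
  B : S → S → ℝ≥0
  /-- the row sums are at most one -/
  subStochastic : ∀ x, ∑' y, (B x y : ℝ≥0∞) ≤ 1
  /-- the regeneration probability -/
  δ : ℝ≥0
  δ_pos : 0 < δ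
  /-- the regeneration distribution -/
  ψ : PMF S
  /-- `B̃ = B - δ ψ` is non-negative -/
  minorization : ∀ x y, (δ : ℝ≥0∞) * ψ y ≤ B x y

/-- The state space of the split chain: `dead` is the cemetery `Δ`; `alive y b` says that the
chain `X` is at `y ∈ S`, and `b = true` exactly if the transition into this state was a
regeneration, i.e. was made by sampling from `ψ`. -/
inductive SplitState (S : Type*)
  | dead : SplitState S
  | alive (y : S) (b : Bool) : SplitState S

/-- The split states as an option type, for summation over them. -/
def SplitState.equivOption (S : Type*) : Option (S × Bool) ≃ SplitState S where
  toFun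
    | none => .dead
    | some (y, b) => .alive y b
  invFun
    | .dead => none
    | .alive y b => some (y, b)
  left_inv := by rintro (_ | ⟨y, b⟩) <;> rfl
  right_inv := by rintro (_ | ⟨y, b⟩) <;> rfl

/-- All sets of states are measurable. -/
instance (S : Type*) : MeasurableSpace (SplitState S) := ⊤

/-- The entries of `B ^ n`, for a possibly infinite matrix with non-negative entries. -/
noncomputable def matPow {S : Type*} (B : S → S → ℝ≥0) : ℕ → S → S → ℝ≥0∞
  | 0, x, y => ({x} : Set S).indicator 1 y
  | n + 1, x, y => ∑' w, (B x w : ℝ≥0∞) * matPow B n w y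

/-- The period of the state `z`: the greatest common divisor of `{k ≥ 1 | B ^ k (z, z) > 0}`, as
the largest of the common divisors. For irreducible `B` it does not depend on `z`. -/
noncomputable def matPeriod {S : Type*} (B : S → S → ℝ≥0) (z : S) : ℕ :=
  sSup {d : ℕ | ∀ k : ℕ, 1 ≤ k → 0 < matPow B k z z → d ∣ k}

namespace SplitMatrix

variable {S : Type*} (M : SplitMatrix S)

/-- The residual matrix `B̃ = B - δ ψ`. -/
noncomputable def Btilde (x y : S) : ℝ≥0∞ := (M.B x y : ℝ≥0∞) - (M.δ : ℝ≥0∞) * M.ψ y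

/-- One-step transition probabilities of the split chain. From `x ∈ S`: with probability `δ` the
next state is sampled from `ψ` (and marked as a regeneration), with probability `B̃ x y` the next
state is `y` (not marked), with probability `1 - ∑ y, B x y` the chain is killed. The cemetery is
absorbing. -/
noncomputable def stepMass : SplitState S → SplitState S → ℝ≥0∞
  | .alive _ _, .alive y true => (M.δ : ℝ≥0∞) * M.ψ y
  | .alive x _, .alive y false => M.Btilde x y
  | .alive x _, .dead => 1 - ∑' y, (M.B x y : ℝ≥0∞)
  | .dead, .alive _ _ => 0
  | .dead, .dead => 1

theorem tsum_stepMass (s : SplitState S) : ∑' t, M.stepMass s t = 1 := by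
  have hsplit : ∀ f : SplitState S → ℝ≥0∞,
      ∑' t, f t = f .dead + ∑' y : S, (f (.alive y true) + f (.alive y false)) := by
    intro f
    rw [← (SplitState.equivOption S).tsum_eq f,
      ← (Equiv.optionEquivSumPUnit.{0} (S × Bool)).symm.tsum_eq,
      ENNReal.summable.tsum_sum ENNReal.summable, add_comm]
    simp [SplitState.equivOption, ENNReal.tsum_prod', tsum_fintype]
  rw [hsplit]
  match s with
  | .dead => simp [stepMass]
  | .alive x b =>
    have h : ∀ y, M.stepMass (.alive x b) (.alive y true) +
        M.stepMass (.alive x b) (.alive y false) = (M.B x y : ℝ≥0∞) := fun y =>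
      add_tsub_cancel_of_le (M.minorization x y)
    rw [tsum_congr h]
    exact tsub_add_cancel_of_le (M.subStochastic x)

/-- The transition law of the split chain out of a state. -/
noncomputable def stepPMF (s : SplitState S) : PMF (SplitState S) :=
  ⟨M.stepMass s, M.tsum_stepMass s ▸ ENNReal.summable.hasSum⟩

/-- The transition kernel of the split chain. -/
noncomputable def stepKernel : Kernel (SplitState S) (SplitState S) where
  toFun s := (M.stepPMF s).toMeasure
  measurable' := measurable_from_top

instance : IsMarkovKernel M.stepKernel :=
  ⟨fun s => inferInstanceAs (IsProbabilityMeasure (M.stepPMF s).toMeasure)⟩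

/-- The transition kernel at time `n`, as a function of the history up to time `n`; it only looks
at the present state. -/
noncomputable def histKernel (n : ℕ) :
    Kernel (Π _ : Finset.Iic n, SplitState S) (SplitState S) :=
  M.stepKernel.comap (fun h => h ⟨n, Finset.mem_Iic.2 le_rfl⟩) (measurable_pi_apply _)

instance (n : ℕ) : IsMarkovKernel (M.histKernel n) :=
  inferInstanceAs (IsMarkovKernel (M.stepKernel.comap _ _))

/-- `P_x`: the law on path space of the split chain started from `X_0 = x`. -/
noncomputable def pathLaw (x : S) : Measure (ℕ → SplitState S) :=
  Kernel.traj (X := fun _ => SplitState S) M.histKernel 0 (fun _ => .alive x false)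

/-- `E_x f` for a non-negative `f`. -/
noncomputable def expect (x : S) (f : (ℕ → SplitState S) → ℝ≥0∞) : ℝ≥0∞ :=
  ∫⁻ ω, f ω ∂(M.pathLaw x)

/-- `E_ψ f = ∑ x, ψ x * E_x f` for a non-negative `f`. -/
noncomputable def expectPsi (f : (ℕ → SplitState S) → ℝ≥0∞) : ℝ≥0∞ :=
  ∑' x, M.ψ x * M.expect x f

end SplitMatrix

namespace SplitPath

variable {S : Type*}

/-- The event `X_n = y`, for `y ∈ S`. -/
def At (n : ℕ) (y : S) (ω : ℕ → SplitState S) : Prop := ∃ b : Bool, ω n = .alive y b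

/-- `T = inf {n ≥ 0 | X_n = Δ}`, the (possibly infinite) hitting time of the cemetery. -/
noncomputable def T (ω : ℕ → SplitState S) : ℕ∞ := ⨅ (n : ℕ) (_ : ω n = .dead), (n : ℕ∞)

/-- The (possibly infinite) first time `n ≥ 1` at which the chain distributes itself according
to `ψ`. -/
noncomputable def τ (ω : ℕ → SplitState S) : ℕ∞ :=
  ⨅ (n : ℕ) (_ : 1 ≤ n ∧ ∃ y : S, ω n = .alive y true), (n : ℕ∞)

/-- `e ^ (θ t)` for a possibly infinite time `t`. For `t = ∞` this is `∞`, `1`, `0` according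
as `θ > 0`, `θ = 0`, `θ < 0`. -/
noncomputable def expTime (θ : ℝ) (t : ℕ∞) : ℝ≥0∞ :=
  EReal.exp ((θ : EReal) * ((t : ℝ≥0∞) : EReal))

end SplitPath

namespace SplitMatrix

open SplitPath

variable {S : Type*} (M : SplitMatrix S)

/-- `θ₁ = sup {θ | E_ψ e^{θ T} < ∞}`, an extended real number. -/
noncomputable def θ₁ : EReal :=
  ⨆ (θ : ℝ) (_ : M.expectPsi (fun ω => expTime θ (T ω)) < ∞), (θ : EReal)

/-- `θ₂ = sup {θ | E_ψ e^{θ (T ∧ τ)} < ∞}`, an extended real number. -/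
noncomputable def θ₂ : EReal :=
  ⨆ (θ : ℝ) (_ : M.expectPsi (fun ω => expTime θ (min (T ω) (τ ω))) < ∞), (θ : EReal)

/-- The random variable `e^{θ τ} I(T > τ)`. (`T > τ` forces `τ < ∞`.) -/
noncomputable def regenWeight (θ : ℝ) : (ℕ → SplitState S) → ℝ≥0∞ :=
  {ω | τ ω < T ω}.indicator fun ω => expTime θ (τ ω)

/-- `u_*(x) = E_x e^{θ τ} I(T > τ)`. -/
noncomputable def uStar (θ : ℝ) (x : S) : ℝ≥0∞ := M.expect x (regenWeight θ)

/-- `η_*(y) = E_ψ ∑_{j = 0}^{τ - 1} e^{θ j} I(X_j = y, T > j)`. -/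
noncomputable def ηStar (θ : ℝ) (y : S) : ℝ≥0∞ :=
  M.expectPsi fun ω => ∑' j : ℕ,
    {ω | (j : ℕ∞) < τ ω ∧ At j y ω ∧ (j : ℕ∞) < T ω}.indicator (fun _ => expTime θ (j : ℕ∞)) ω

/-- `λ_* = e^{-θ}`. -/
noncomputable def lamStar (θ : ℝ) : ℝ≥0∞ := ENNReal.ofReal (Real.exp (-θ))

end SplitMatrix

/-! `B` is a rank-one perturbation of `B̃`, so its spectral theory reduces to the scalar F(r) = ∑
rⁿ⁺¹ δ ψB̃ⁿ1, with r = e^θ. The Markov property identifies F(r) with E_ψ e^{θτ} I(T > τ), u_* with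
rδ ∑ rⁿ B̃ⁿ1 (`colVec`) and η_* with ∑ rⁿ ψB̃ⁿ (`rowVec`). The equation Bu = r⁻¹u reads u = rδψ(u)1
+ rB̃u. It is solved by `colVec` when F(r) = 1, and dually for rows. Iterating it shows that any
positive solution dominates a multiple of this one. Equality of total masses then turns domination
into equality (`eq_mul_colVec`, `eq_mul_rowVec`).

For θ between θ₁ and θ₂ the series F is finite, and F ≥ 1, since F < 1 would make the regeneration
cycles a convergent geometric series and E_ψ e^{θT} finite (`one_le_of_mem_Ioo`). As F is continuous
with F(0) = 0, the value 1 is attained. As F is strictly increasing, every solution lies strictly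
below some θ' at which the resolvent series is still finite. Cycle weights at θ therefore have
geometric tails, and ∑ η_* u_*, which is the mean cycle length, is finite.

When F(r) = 1 the cycle weights form a probability distribution, and rⁿ ψBⁿ(y) solves a renewal
equation. The weight of length 1 is rδ > 0, so the renewal theorem (`renewal_tendsto`) applies
without periodicity. Conditioning on the first regeneration transfers the limit to rⁿ Bⁿ(x, y). The
same minorization makes the period of `B` equal to 1. -/

theorem ENat.natCast_lt_iInf_iff {P : ℕ → Prop} {n : ℕ} :
    (n : ℕ∞) < ⨅ (m : ℕ) (_ : P m), (m : ℕ∞) ↔ ∀ m ≤ n, ¬ P m := by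
  rw [← Order.add_one_le_iff_of_not_isMax (by simp), le_iInf₂_iff]
  constructor
  · intro h m hm hP
    have := h m hP
    norm_cast at this
    omega
  · intro h m hP
    have : n < m := by
      by_contra hc
      exact h m (by omega) hP
    exact_mod_cast this

/-! ### Exponentials of random times -/

namespace SplitPath

variable {S : Type*}

theorem expTime_natCast (θ : ℝ) (n : ℕ) :
    expTime θ n = ENNReal.ofReal (Real.exp θ) ^ n := by
  have h : (θ : EReal) * (((n : ℕ∞) : ℝ≥0∞) : EReal) = ((n * θ : ℝ) : EReal) := by
    rw [mul_comm]
    push_cast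
    rfl
  rw [expTime, h, EReal.exp_coe, Real.exp_nat_mul, ENNReal.ofReal_pow (Real.exp_pos _).le]

theorem expTime_top {θ : ℝ} (hθ : 0 < θ) : expTime θ ⊤ = ∞ := by
  simp [expTime, EReal.coe_mul_top_of_pos hθ]

theorem expTime_zero (t : ℕ∞) : expTime 0 t = 1 := by
  simp [expTime]

theorem expTime_mono {θ θ' : ℝ} (h : θ ≤ θ') (t : ℕ∞) : expTime θ t ≤ expTime θ' t := by
  refine EReal.exp_monotone ?_
  exact mul_le_mul_of_nonneg_right (by exact_mod_cast h) (by positivity)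

/-- A geometric sum, which reduces exponential moments to the probabilities of n < t. For t = ∞ both
sides are infinite because θ > 0. -/
theorem expTime_eq_one_add_tsum {θ : ℝ} (hθ : 0 < θ) (t : ℕ∞) :
    expTime θ t = 1 + (ENNReal.ofReal (Real.exp θ) - 1) *
      ∑' n : ℕ, {n : ℕ | (n : ℕ∞) < t}.indicator
        (fun n => ENNReal.ofReal (Real.exp θ) ^ n) n := by
  have hr : 1 < ENNReal.ofReal (Real.exp θ) := by
    rw [← ENNReal.ofReal_one]
    exact (ENNReal.ofReal_lt_ofReal_iff (Real.exp_pos _)).2 (Real.one_lt_exp_iff.2 hθ)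
  set r := ENNReal.ofReal (Real.exp θ) with hrdef
  induction t using ENat.recTopCoe with
  | top =>
    have : ∑' n : ℕ, {n : ℕ | (n : ℕ∞) < ⊤}.indicator (fun n => r ^ n) n = ∞ := by
      rw [← top_le_iff, ← ENNReal.tsum_const_eq_top_of_ne_zero (α := ℕ) one_ne_zero]
      refine ENNReal.tsum_le_tsum fun n => ?_
      simp [one_le_pow₀ hr.le]
    rw [this, expTime_top hθ, ENNReal.mul_top (tsub_pos_of_lt hr).ne']
    simp
  | coe N =>
    have : ∑' n : ℕ, {n : ℕ | (n : ℕ∞) < N}.indicator (fun n => r ^ n) n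
        = ∑ n ∈ Finset.range N, r ^ n := by
      rw [tsum_eq_sum (s := Finset.range N)]
      · refine Finset.sum_congr rfl fun n hn => ?_
        rw [Set.indicator_of_mem]
        simpa using hn
      · intro n hn
        rw [Set.indicator_of_notMem]
        simpa using hn
    rw [this, expTime_natCast]
    clear this
    induction N with
    | zero => simp
    | succ N ih =>
      rw [Finset.sum_range_succ, mul_add, ← add_assoc, ← ih, pow_succ, ← hrdef]
      nth_rw 2 [← add_tsub_cancel_of_le hr.le]
      rw [mul_add, mul_one, mul_comm (r ^ N)]

theorem lt_T_iff {n : ℕ} {ω : ℕ → SplitState S} : (n : ℕ∞) < T ω ↔ ∀ k ≤ n, ω k ≠ .dead :=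
  ENat.natCast_lt_iInf_iff

theorem lt_τ_iff {n : ℕ} {ω : ℕ → SplitState S} :
    (n : ℕ∞) < τ ω ↔ ∀ k ≤ n, 1 ≤ k → ∀ y, ω k ≠ .alive y true := by
  rw [τ, ENat.natCast_lt_iInf_iff]
  simp

end SplitPath

namespace SplitState

variable {S : Type*}

theorem tsum_eq (f : SplitState S → ℝ≥0∞) :
    ∑' t, f t = f .dead + ∑' y : S, (f (.alive y true) + f (.alive y false)) := by
  rw [← (SplitState.equivOption S).tsum_eq f,
    ← (Equiv.optionEquivSumPUnit.{0} (S × Bool)).symm.tsum_eq,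
    ENNReal.summable.tsum_sum ENNReal.summable, add_comm]
  simp [SplitState.equivOption, ENNReal.tsum_prod', tsum_fintype]

instance [Countable S] : Countable (SplitState S) :=
  (SplitState.equivOption S).symm.injective.countable

instance : DiscreteMeasurableSpace (SplitState S) := ⟨fun _ => trivial⟩

end SplitState

/-- The action of a non-negative matrix on non-negative column vectors. -/
noncomputable def colOp {S : Type*} (K : S → S → ℝ≥0∞) (v : S → ℝ≥0∞) (x : S) : ℝ≥0∞ :=
  ∑' y, K x y * v y

/-! ### Path expectations as series in matrix powers -/

namespace SplitMatrix

open SplitPath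

variable {S : Type*} (M : SplitMatrix S)

/-- The entries of `B` as extended non-negative numbers. -/
noncomputable def Be (x y : S) : ℝ≥0∞ := M.B x y

theorem Be_eq (x y : S) : M.Be x y = M.δ * M.ψ y + M.Btilde x y :=
  (add_tsub_cancel_of_le (M.minorization x y)).symm

instance (x : S) : IsProbabilityMeasure (M.pathLaw x) := by
  unfold pathLaw
  infer_instance

theorem lintegral_stepKernel [Countable S] (s : SplitState S) (g : SplitState S → ℝ≥0∞) :
    ∫⁻ t, g t ∂M.stepKernel s = ∑' t, M.stepMass s t * g t := by
  rw [lintegral_countable']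
  refine tsum_congr fun t => ?_
  rw [mul_comm]
  congr 1
  exact PMF.toMeasure_apply_singleton _ _ (MeasurableSet.singleton _)

theorem lintegral_pathLaw_zero (x : S) (g : SplitState S → ℝ≥0∞) :
    ∫⁻ ω, g (ω 0) ∂M.pathLaw x = g (.alive x false) := by
  rw [pathLaw, Kernel.lintegral_traj]
  · simp [Function.updateFinset]
  · exact measurable_from_top.comp (measurable_pi_apply 0)

/-- The Markov property of the split chain. -/
theorem lintegral_pathLaw_succ [Countable S] (x : S) (n : ℕ)
    (h : (Π _ : Finset.Iic n, SplitState S) → ℝ≥0∞) (hh : Measurable h)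
    (g : SplitState S → ℝ≥0∞) :
    ∫⁻ ω, h (Preorder.frestrictLe n ω) * g (ω (n + 1)) ∂M.pathLaw x =
      ∫⁻ ω, h (Preorder.frestrictLe n ω) * ∑' t, M.stepMass (ω n) t * g t ∂M.pathLaw x := by
  have hg : Measurable g := measurable_from_top
  have hm : Measurable fun ω : ℕ → SplitState S =>
      h (Preorder.frestrictLe n ω) * g (ω (n + 1)) := by fun_prop
  have hm' : Measurable fun y : (Π _ : Finset.Iic n, SplitState S) =>
      h y * ∑' t, M.stepMass (y ⟨n, Finset.mem_Iic.2 le_rfl⟩) t * g t :=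
    hh.mul ((measurable_from_top (f := fun s => ∑' t, M.stepMass s t * g t)).comp
      (measurable_pi_apply _))
  -- The trajectory is restarted at time n: given the history, the first factor is frozen and only
  -- coordinate n + 1 is integrated.
  have hcomp := Kernel.traj_comp_partialTraj (X := fun _ => SplitState S) (κ := M.histKernel)
    (Nat.zero_le n)
  have hleft : ∫⁻ ω, h (Preorder.frestrictLe n ω) * g (ω (n + 1)) ∂M.pathLaw x =
      ∫⁻ ω, h (Preorder.frestrictLe n ω) * g (ω (n + 1))
        ∂(Kernel.traj (X := fun _ => SplitState S) M.histKernel n ∘ₖ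
          Kernel.partialTraj (X := fun _ => SplitState S) M.histKernel 0 n)
            (fun _ => .alive x false) := by
    rw [hcomp]
    rfl
  rw [hleft, Kernel.lintegral_comp _ _ _ hm]
  have inner (y : Π _ : Finset.Iic n, SplitState S) :
      ∫⁻ ω, h (Preorder.frestrictLe n ω) * g (ω (n + 1))
        ∂Kernel.traj (X := fun _ => SplitState S) M.histKernel n y =
        h y * ∑' t, M.stepMass (y ⟨n, Finset.mem_Iic.2 le_rfl⟩) t * g t := by
    rw [Kernel.lintegral_traj _ hm]
    have h1 (ω : ℕ → SplitState S) :
        Preorder.frestrictLe n (Function.updateFinset ω (Finset.Iic n) y) = y := by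
      ext i
      simp [Function.updateFinset]
    have h2 (ω : ℕ → SplitState S) :
        Function.updateFinset ω (Finset.Iic n) y (n + 1) = ω (n + 1) := by
      simp [Function.updateFinset]
    simp_rw [h1, h2]
    rw [lintegral_const_mul _ (by fun_prop), ← M.lintegral_stepKernel]
    congr 1
    have h3 := DFunLike.congr_fun (Kernel.map_traj_succ_self
      (X := fun _ => SplitState S) (κ := M.histKernel) (a := n)) y
    have h4 : M.histKernel n y = M.stepKernel (y ⟨n, Finset.mem_Iic.2 le_rfl⟩) := rfl
    rw [← h4, ← h3, Kernel.map_apply _ (measurable_pi_apply _),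
      lintegral_map hg (by fun_prop)]
  simp_rw [inner]
  rw [pathLaw, ← Kernel.traj_map_frestrictLe_apply, lintegral_map hm' (by fun_prop)]
  rfl

/-- The law of the split chain killed on leaving `D`. -/
theorem lintegral_pathLaw_killed [Countable S] (x : S) (D : Set (SplitState S))
    (hx : .alive x false ∈ D) (R : (SplitState S → ℝ≥0∞) → SplitState S → ℝ≥0∞)
    (hR : ∀ g, ∀ s ∈ D, ∑' t, M.stepMass s t * (D.indicator g t) = R g s)
    (n : ℕ) (g : SplitState S → ℝ≥0∞) :
    ∫⁻ ω, {ω : ℕ → SplitState S | ∀ k ≤ n, ω k ∈ D}.indicator (fun ω => g (ω n)) ω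
      ∂M.pathLaw x = R^[n] g (.alive x false) := by
  classical
  induction n generalizing g with
  | zero =>
    have : ∀ ω : ℕ → SplitState S,
        {ω : ℕ → SplitState S | ∀ k ≤ 0, ω k ∈ D}.indicator (fun ω => g (ω 0)) ω =
          D.indicator g (ω 0) := by
      intro ω
      simp [Set.indicator_apply]
    simp_rw [this, lintegral_pathLaw_zero]
    simp [hx]
  | succ n ih =>
    let E : Set (Π _ : Finset.Iic n, SplitState S) := {h | ∀ k, h k ∈ D}
    have hE : MeasurableSet E := by
      have : E = ⋂ k, (fun h => h k) ⁻¹' D := by ext; simp [E]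
      rw [this]
      exact MeasurableSet.iInter fun k => measurable_pi_apply k trivial
    have hE' (ω : ℕ → SplitState S) : Preorder.frestrictLe n ω ∈ E ↔ ∀ k ≤ n, ω k ∈ D := by
      simp [E]
    have h1 (ω : ℕ → SplitState S) :
        {ω : ℕ → SplitState S | ∀ k ≤ n + 1, ω k ∈ D}.indicator (fun ω => g (ω (n + 1))) ω =
          E.indicator (fun _ => 1) (Preorder.frestrictLe n ω) * D.indicator g (ω (n + 1)) := by
      have : (∀ k ≤ n + 1, ω k ∈ D) ↔ (∀ k ≤ n, ω k ∈ D) ∧ ω (n + 1) ∈ D := by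
        simp [Nat.le_succ_iff, or_imp, forall_and]
      simp only [Set.indicator_apply, hE', Set.mem_ofPred_eq, this]
      split_ifs <;> simp_all
    simp_rw [h1]
    rw [M.lintegral_pathLaw_succ x n _ (measurable_const.indicator hE), Function.iterate_succ_apply,
      ← ih]
    refine lintegral_congr fun ω => ?_
    simp only [Set.indicator_apply, hE', Set.mem_ofPred_eq]
    split_ifs with h
    · rw [one_mul, ← hR _ _ (h n le_rfl)]
      simp [Set.indicator_apply]
    · simp

theorem ae_pathLaw_zero (x : S) : ∀ᵐ ω ∂M.pathLaw x, ω 0 = .alive x false := by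
  have h := M.lintegral_pathLaw_zero x (({.alive x false}ᶜ : Set (SplitState S)).indicator 1)
  rw [Set.indicator_of_notMem (by simp), lintegral_eq_zero_iff] at h
  · filter_upwards [h] with ω hω
    by_contra hc
    rw [Set.indicator_of_mem (by simpa using hc)] at hω
    simp at hω
  · have hm : Measurable (({.alive x false}ᶜ : Set (SplitState S)).indicator
      (1 : SplitState S → ℝ≥0∞)) := measurable_from_top
    exact hm.comp (measurable_pi_apply 0)

/-- States that the chain has entered without regeneration. -/
def unmarked (S : Type*) : Set (SplitState S) := Set.range fun y => .alive y false

/-- States other than the cemetery. -/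
def living (S : Type*) : Set (SplitState S) := {.dead}ᶜ

/-- The expectation of `g (X_n)` before regeneration and death. -/
theorem lintegral_unmarked [Countable S] (x : S) (n : ℕ) (g : SplitState S → ℝ≥0∞) :
    ∫⁻ ω, {ω : ℕ → SplitState S | ∀ k ≤ n, ω k ∈ unmarked S}.indicator (fun ω => g (ω n)) ω
      ∂M.pathLaw x = (colOp M.Btilde)^[n] (fun y => g (.alive y false)) x := by
  rw [M.lintegral_pathLaw_killed x (unmarked S) ⟨x, rfl⟩
    (fun g s => match s with
      | .alive x _ => colOp M.Btilde (fun y => g (.alive y false)) x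
      | .dead => 0)]
  · induction n generalizing g with
    | zero => rfl
    | succ n ih =>
      rw [Function.iterate_succ_apply, ih, Function.iterate_succ_apply]
  · rintro g s ⟨y, rfl⟩
    rw [SplitState.tsum_eq]
    simp [unmarked, colOp, stepMass]

/-- A function on `S`, extended by zero to the cemetery. -/
def _root_.SplitState.lift (g : S → ℝ≥0∞) : SplitState S → ℝ≥0∞
  | .alive y _ => g y
  | .dead => 0

/-- The expectation of `g (X_n)` before death. -/
theorem lintegral_living [Countable S] (x : S) (n : ℕ) (g : S → ℝ≥0∞) :
    ∫⁻ ω, {ω : ℕ → SplitState S | ∀ k ≤ n, ω k ∈ living S}.indicator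
      (fun ω => SplitState.lift g (ω n)) ω ∂M.pathLaw x = (colOp M.Be)^[n] g x := by
  rw [M.lintegral_pathLaw_killed x (living S) (by simp [living])
    (fun g s => ∑' t, M.stepMass s t * ((living S).indicator g t)) (fun _ _ _ => rfl)]
  suffices h : (fun (g : SplitState S → ℝ≥0∞) s =>
      ∑' t, M.stepMass s t * ((living S).indicator g t))^[n] (SplitState.lift g) =
        SplitState.lift ((colOp M.Be)^[n] g) by
    rw [h]
    rfl
  induction n generalizing g with
  | zero => rfl
  | succ n ih =>
    rw [Function.iterate_succ_apply, Function.iterate_succ_apply, ← ih]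
    congr 1
    ext s
    rw [SplitState.tsum_eq]
    cases s with
    | dead => simp [living, stepMass, SplitState.lift]
    | alive x b =>
      simp [living, stepMass, SplitState.lift, colOp, Be_eq, add_mul]

variable {M} in
-- Since `τ` ignores time 0, the equivalence needs the initial state to be unmarked, which holds
-- almost surely.
theorem ae_lt_min_iff (x : S) (n : ℕ) : ∀ᵐ ω ∂M.pathLaw x,
    ((n : ℕ∞) < τ ω ∧ (n : ℕ∞) < T ω ↔ ∀ k ≤ n, ω k ∈ unmarked S) := by
  filter_upwards [M.ae_pathLaw_zero x] with ω h0
  rw [lt_T_iff, lt_τ_iff]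
  constructor
  · rintro ⟨h1, h2⟩ k hk
    obtain rfl | hk1 := Nat.eq_zero_or_pos k
    · exact ⟨x, h0.symm⟩
    · specialize h1 k hk hk1
      specialize h2 k hk
      generalize ω k = s at h1 h2
      match s with
      | .dead => exact absurd rfl h2
      | .alive y true => exact absurd rfl (h1 y)
      | .alive y false => exact ⟨y, rfl⟩
  · intro h
    constructor <;> intro k hk <;> obtain ⟨y, hy⟩ := h k hk <;> simp [← hy]

theorem measurableSet_unmarked (n : ℕ) :
    MeasurableSet {ω : ℕ → SplitState S | ∀ k ≤ n, ω k ∈ unmarked S} := by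
  have : {ω : ℕ → SplitState S | ∀ k ≤ n, ω k ∈ unmarked S} =
      ⋂ k, ⋂ (_ : k ≤ n), (fun ω => ω k) ⁻¹' unmarked S := by ext; simp
  rw [this]
  exact MeasurableSet.iInter fun k => MeasurableSet.iInter fun _ => measurable_pi_apply k trivial

theorem measurableSet_living (n : ℕ) :
    MeasurableSet {ω : ℕ → SplitState S | ∀ k ≤ n, ω k ∈ living S} := by
  have : {ω : ℕ → SplitState S | ∀ k ≤ n, ω k ∈ living S} =
      ⋂ k, ⋂ (_ : k ≤ n), (fun ω => ω k) ⁻¹' living S := by ext; simp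
  rw [this]
  exact MeasurableSet.iInter fun k => MeasurableSet.iInter fun _ => measurable_pi_apply k trivial

/-- The total mass under `ψ` of a function. -/
noncomputable def psi (v : S → ℝ≥0∞) : ℝ≥0∞ := ∑' x, M.ψ x * v x

theorem expect_expTime_T [Countable S] {θ : ℝ} (hθ : 0 < θ) (x : S) :
    M.expect x (fun ω => expTime θ (T ω)) = 1 + (ENNReal.ofReal (Real.exp θ) - 1) *
      ∑' n : ℕ, ENNReal.ofReal (Real.exp θ) ^ n * (colOp M.Be)^[n] 1 x := by
  have h (ω : ℕ → SplitState S) : expTime θ (T ω) = 1 + (ENNReal.ofReal (Real.exp θ) - 1) *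
      ∑' n : ℕ, ENNReal.ofReal (Real.exp θ) ^ n *
        {ω : ℕ → SplitState S | ∀ k ≤ n, ω k ∈ living S}.indicator
          (fun ω => SplitState.lift 1 (ω n)) ω := by
    rw [expTime_eq_one_add_tsum hθ]
    congr 2
    refine tsum_congr fun n => ?_
    have : ω ∈ {ω : ℕ → SplitState S | ∀ k ≤ n, ω k ∈ living S} ↔ (n : ℕ∞) < T ω := by
      rw [lt_T_iff]; rfl
    by_cases hn : (n : ℕ∞) < T ω
    · rw [Set.indicator_of_mem (by exact hn), Set.indicator_of_mem (this.2 hn)]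
      have hne := lt_T_iff.1 hn n le_rfl
      generalize ω n = s at hne
      cases s with
      | dead => exact absurd rfl hne
      | alive y b => simp [SplitState.lift]
    · rw [Set.indicator_of_notMem (by exact hn), Set.indicator_of_notMem (by rwa [this]), mul_zero]
  have hm (n : ℕ) : Measurable ({ω : ℕ → SplitState S | ∀ k ≤ n, ω k ∈ living S}.indicator
      (fun ω => SplitState.lift (1 : S → ℝ≥0∞) (ω n))) :=
    ((measurable_from_top (f := SplitState.lift (1 : S → ℝ≥0∞))).comp
      (measurable_pi_apply (X := fun _ => SplitState S) n)).indicator (measurableSet_living n)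
  rw [expect]
  simp_rw [h]
  rw [lintegral_add_left measurable_const, lintegral_const, measure_univ, mul_one,
    lintegral_const_mul _ (Measurable.tsum fun n => (hm n).const_mul _),
    lintegral_tsum fun n => ((hm n).const_mul _).aemeasurable]
  simp_rw [lintegral_const_mul _ (hm _), M.lintegral_living]

theorem expect_expTime_min [Countable S] {θ : ℝ} (hθ : 0 < θ) (x : S) :
    M.expect x (fun ω => expTime θ (min (T ω) (τ ω))) = 1 + (ENNReal.ofReal (Real.exp θ) - 1) *
      ∑' n : ℕ, ENNReal.ofReal (Real.exp θ) ^ n * (colOp M.Btilde)^[n] 1 x := by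
  have h : ∀ᵐ ω ∂M.pathLaw x, expTime θ (min (T ω) (τ ω)) =
      1 + (ENNReal.ofReal (Real.exp θ) - 1) * ∑' n : ℕ, ENNReal.ofReal (Real.exp θ) ^ n *
        {ω : ℕ → SplitState S | ∀ k ≤ n, ω k ∈ unmarked S}.indicator (fun _ => 1) ω := by
    filter_upwards [ae_all_iff.2 (ae_lt_min_iff (M := M) x)] with ω hω
    rw [expTime_eq_one_add_tsum hθ]
    congr 2
    refine tsum_congr fun n => ?_
    have : ω ∈ {ω : ℕ → SplitState S | ∀ k ≤ n, ω k ∈ unmarked S} ↔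
        (n : ℕ∞) < min (T ω) (τ ω) := by
      rw [lt_min_iff, and_comm, hω n]; rfl
    by_cases hn : (n : ℕ∞) < min (T ω) (τ ω)
    · rw [Set.indicator_of_mem (by exact hn), Set.indicator_of_mem (this.2 hn), mul_one]
    · rw [Set.indicator_of_notMem (by exact hn), Set.indicator_of_notMem (by rwa [this]), mul_zero]
  have hm (n : ℕ) : Measurable ({ω : ℕ → SplitState S | ∀ k ≤ n, ω k ∈ unmarked S}.indicator
      (fun _ => (1 : ℝ≥0∞))) := measurable_const.indicator (measurableSet_unmarked n)
  rw [expect, lintegral_congr_ae h, lintegral_add_left measurable_const, lintegral_const,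
    measure_univ, mul_one,
    lintegral_const_mul _ (Measurable.tsum fun n => (hm n).const_mul _),
    lintegral_tsum fun n => ((hm n).const_mul _).aemeasurable]
  simp_rw [lintegral_const_mul _ (hm _)]
  have (n : ℕ) := M.lintegral_unmarked x n (fun _ => 1)
  simp_rw [this]
  rfl

theorem ηStar_eq [Countable S] (θ : ℝ) (y : S) :
    M.ηStar θ y = M.psi fun x => ∑' n : ℕ, ENNReal.ofReal (Real.exp θ) ^ n *
      (colOp M.Btilde)^[n] (({y} : Set S).indicator 1) x := by
  rw [ηStar, expectPsi, psi]
  refine tsum_congr fun x => ?_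
  congr 1
  let g : SplitState S → ℝ≥0∞ := SplitState.lift (({y} : Set S).indicator 1)
  have h : ∀ᵐ ω ∂M.pathLaw x, ∑' j : ℕ,
      {ω | (j : ℕ∞) < τ ω ∧ At j y ω ∧ (j : ℕ∞) < T ω}.indicator
        (fun _ => expTime θ (j : ℕ∞)) ω = ∑' n : ℕ, ENNReal.ofReal (Real.exp θ) ^ n *
        {ω : ℕ → SplitState S | ∀ k ≤ n, ω k ∈ unmarked S}.indicator (fun ω => g (ω n)) ω := by
    filter_upwards [ae_all_iff.2 (ae_lt_min_iff (M := M) x)] with ω hω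
    refine tsum_congr fun n => ?_
    specialize hω n
    rw [expTime_natCast]
    by_cases hn : ∀ k ≤ n, ω k ∈ unmarked S
    · rw [Set.indicator_of_mem (s := {ω : ℕ → SplitState S | ∀ k ≤ n, ω k ∈ unmarked S}) hn]
      obtain ⟨z, hz⟩ := hn n le_rfl
      obtain ⟨h1, h2⟩ := hω.2 hn
      have : At n y ω ↔ z = y := by simp [At, ← hz]
      by_cases hzy : z = y
      · rw [Set.indicator_of_mem (by exact ⟨h1, this.2 hzy, h2⟩)]
        simp [g, ← hz, SplitState.lift, hzy]
      · rw [Set.indicator_of_notMem (by simp [this, hzy])]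
        simp [g, ← hz, SplitState.lift, hzy]
    · rw [Set.indicator_of_notMem (s := {ω : ℕ → SplitState S | ∀ k ≤ n, ω k ∈ unmarked S}) hn,
        mul_zero, Set.indicator_of_notMem]
      rintro ⟨h1, -, h2⟩
      exact hn (hω.1 ⟨h1, h2⟩)
  have hm (n : ℕ) : Measurable ({ω : ℕ → SplitState S | ∀ k ≤ n, ω k ∈ unmarked S}.indicator
      (fun ω => g (ω n))) :=
    ((measurable_from_top (f := g)).comp
      (measurable_pi_apply (X := fun _ => SplitState S) n)).indicator (measurableSet_unmarked n)
  rw [expect, lintegral_congr_ae h, lintegral_tsum fun n => ((hm n).const_mul _).aemeasurable]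
  simp_rw [lintegral_const_mul _ (hm _), M.lintegral_unmarked]
  rfl

/-- Regeneration, as a function of the state just entered. -/
def _root_.SplitState.mark : SplitState S → ℝ≥0∞
  | .alive _ true => 1
  | _ => 0

/-- The n-th term is the event τ = n + 1 < T: unmarked through time n, then a regeneration, whose
probability δ does not depend on the current state. -/
theorem uStar_eq [Countable S] (θ : ℝ) (x : S) :
    M.uStar θ x = ∑' n : ℕ, ENNReal.ofReal (Real.exp θ) ^ (n + 1) *
      (M.δ * (colOp M.Btilde)^[n] 1 x) := by
  have h : ∀ᵐ ω ∂M.pathLaw x, regenWeight θ ω =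
      ∑' n : ℕ, ENNReal.ofReal (Real.exp θ) ^ (n + 1) *
        ({ω : ℕ → SplitState S | ∀ k ≤ n, ω k ∈ unmarked S}.indicator (fun _ => 1) ω *
          SplitState.mark (ω (n + 1))) := by
    filter_upwards [M.ae_pathLaw_zero x, ae_all_iff.2 (ae_lt_min_iff (M := M) x)] with ω h0 hω
    by_cases hτ : τ ω < T ω
    · rw [regenWeight, Set.indicator_of_mem (by exact hτ)]
      obtain ⟨N, hN⟩ := ENat.ne_top_iff_exists.1 hτ.ne_top
      have hN0 : N ≠ 0 := by
        rintro rfl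
        have : ((0 : ℕ) : ℕ∞) < τ ω := lt_τ_iff.2 fun k hk hk1 => by omega
        simp [← hN] at this
      obtain ⟨n, rfl⟩ := Nat.exists_eq_succ_of_ne_zero hN0
      have hnτ : (n : ℕ∞) < τ ω := by rw [← hN]; exact_mod_cast n.lt_succ_self
      have hmk : ∃ y, ω (n + 1) = .alive y true := by
        have : ¬ ((n + 1 : ℕ) : ℕ∞) < τ ω := by rw [← hN]; simp
        rw [lt_τ_iff] at this hnτ
        push Not at this
        obtain ⟨k, hk, hk1, y, hy⟩ := this
        obtain rfl | hlt := hk.eq_or_lt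
        · exact ⟨y, hy⟩
        · exact absurd hy (hnτ k (by omega) hk1 y)
      obtain ⟨y, hy⟩ := hmk
      rw [tsum_eq_single n, Set.indicator_of_mem, ← hN, expTime_natCast, hy]
      · simp [SplitState.mark]
      · exact (hω n).1 ⟨hnτ, hnτ.trans hτ⟩
      -- Terms with m < n vanish because no mark precedes τ; terms with m > n vanish because the
      -- state at n + 1 is marked.
      · intro m hm
        by_cases hmn : m < n
        · have : (fun s => SplitState.mark s) (ω (m + 1)) = 0 := by
            have hne := lt_τ_iff.1 hnτ (m + 1) (by omega) (by omega)
            generalize ω (m + 1) = s at hne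
            match s with
            | .dead => rfl
            | .alive y true => exact absurd rfl (hne y)
            | .alive y false => rfl
          simp only at this
          rw [this, mul_zero, mul_zero]
        · rw [Set.indicator_of_notMem, zero_mul, mul_zero]
          intro hmem
          obtain ⟨z, hz⟩ := hmem (n + 1) (by omega)
          simp [hy] at hz
    · rw [regenWeight, Set.indicator_of_notMem (by exact hτ), eq_comm, ENNReal.tsum_eq_zero]
      intro n
      by_cases hn : ∀ k ≤ n, ω k ∈ unmarked S
      · have : SplitState.mark (ω (n + 1)) = 0 := by
          have hne : ∀ y, ω (n + 1) ≠ .alive y true := by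
            intro y hy
            refine hτ (lt_of_le_of_lt (b := ((n + 1 : ℕ) : ℕ∞)) ?_ ?_)
            · exact iInf₂_le (n + 1) ⟨by omega, y, hy⟩
            · rw [lt_T_iff]
              intro k hk
              obtain rfl | hlt := hk.eq_or_lt
              · simp [hy]
              · obtain ⟨z, hz⟩ := hn k (by omega)
                simp [← hz]
          generalize ω (n + 1) = s at hne
          match s with
          | .dead => rfl
          | .alive y true => exact absurd rfl (hne y)
          | .alive y false => rfl
        rw [this, mul_zero, mul_zero]
      · rw [Set.indicator_of_notMem (by exact hn), zero_mul, mul_zero]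
  have hm (n : ℕ) : Measurable ({ω : ℕ → SplitState S | ∀ k ≤ n, ω k ∈ unmarked S}.indicator
      (fun _ => (1 : ℝ≥0∞))) := measurable_const.indicator (measurableSet_unmarked n)
  have hm' (n : ℕ) : Measurable fun ω : ℕ → SplitState S =>
      ({ω : ℕ → SplitState S | ∀ k ≤ n, ω k ∈ unmarked S}.indicator (fun _ => (1 : ℝ≥0∞))) ω *
        SplitState.mark (ω (n + 1)) :=
    (hm n).mul ((measurable_from_top (f := SplitState.mark)).comp
      (measurable_pi_apply (X := fun _ => SplitState S) (n + 1)))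
  rw [uStar, expect, lintegral_congr_ae h,
    lintegral_tsum fun n => ((hm' n).const_mul _).aemeasurable]
  refine tsum_congr fun n => ?_
  rw [lintegral_const_mul _ (hm' n)]
  congr 1
  let E : Set (Π _ : Finset.Iic n, SplitState S) := {h | ∀ k, h k ∈ unmarked S}
  have hE : MeasurableSet E := by
    have : E = ⋂ k, (fun h => h k) ⁻¹' unmarked S := by ext; simp [E]
    rw [this]
    exact MeasurableSet.iInter fun k => measurable_pi_apply k trivial
  have hE' (ω : ℕ → SplitState S) : ({ω : ℕ → SplitState S | ∀ k ≤ n, ω k ∈ unmarked S}.indicator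
      (fun _ => (1 : ℝ≥0∞))) ω = E.indicator (fun _ => 1) (Preorder.frestrictLe n ω) := by
    have : (∀ k ≤ n, ω k ∈ unmarked S) ↔ Preorder.frestrictLe n ω ∈ E := by simp [E]
    by_cases hn : ∀ k ≤ n, ω k ∈ unmarked S
    · rw [Set.indicator_of_mem (by exact hn), Set.indicator_of_mem (this.1 hn)]
    · rw [Set.indicator_of_notMem (by exact hn), Set.indicator_of_notMem (by rwa [← this])]
  simp_rw [hE']
  rw [M.lintegral_pathLaw_succ x n _ (measurable_const.indicator hE)]
  simp_rw [← hE']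
  have hstep (ω : ℕ → SplitState S) : ({ω : ℕ → SplitState S | ∀ k ≤ n, ω k ∈ unmarked S}.indicator
      (fun _ => (1 : ℝ≥0∞))) ω * ∑' t, M.stepMass (ω n) t * SplitState.mark t =
      M.δ * ({ω : ℕ → SplitState S | ∀ k ≤ n, ω k ∈ unmarked S}.indicator
      (fun _ => (1 : ℝ≥0∞))) ω := by
    by_cases hn : ∀ k ≤ n, ω k ∈ unmarked S
    · rw [Set.indicator_of_mem (by exact hn), one_mul, mul_one, SplitState.tsum_eq]
      obtain ⟨z, hz⟩ := hn n le_rfl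
      simp [← hz, stepMass, SplitState.mark, ENNReal.tsum_mul_left]
    · rw [Set.indicator_of_notMem (by exact hn), zero_mul, mul_zero]
  simp_rw [hstep]
  rw [lintegral_const_mul _ (hm n), M.lintegral_unmarked x n (fun _ => 1)]
  rfl

end SplitMatrix

/-! ### Linearity of the matrix action, rigidity of sums, irreducibility -/

section colOp

variable {S : Type*} (K : S → S → ℝ≥0∞)

theorem colOp_tsum {ι : Type*} (f : ι → S → ℝ≥0∞) :
    colOp K (fun x => ∑' i, f i x) = fun x => ∑' i, colOp K (f i) x := by
  ext x
  simp_rw [colOp, ← ENNReal.tsum_mul_left]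
  exact ENNReal.tsum_comm

theorem colOp_const_mul (c : ℝ≥0∞) (v : S → ℝ≥0∞) :
    colOp K (fun x => c * v x) = fun x => c * colOp K v x := by
  ext x
  simp_rw [colOp, ← ENNReal.tsum_mul_left]
  exact tsum_congr fun y => by ring

theorem colOp_add (v w : S → ℝ≥0∞) :
    colOp K (fun x => v x + w x) = fun x => colOp K v x + colOp K w x := by
  ext x
  simp_rw [colOp, mul_add]
  exact ENNReal.tsum_add

theorem colOp_mono {v w : S → ℝ≥0∞} (h : ∀ x, v x ≤ w x) (x : S) : colOp K v x ≤ colOp K w x :=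
  ENNReal.tsum_le_tsum fun y => by gcongr; exact h y

theorem colOp_iterate_tsum {ι : Type*} (n : ℕ) (f : ι → S → ℝ≥0∞) :
    (colOp K)^[n] (fun x => ∑' i, f i x) = fun x => ∑' i, (colOp K)^[n] (f i) x := by
  induction n generalizing f with
  | zero => rfl
  | succ n ih => simp_rw [Function.iterate_succ_apply, colOp_tsum, ih]

theorem colOp_iterate_const_mul (n : ℕ) (c : ℝ≥0∞) (v : S → ℝ≥0∞) :
    (colOp K)^[n] (fun x => c * v x) = fun x => c * (colOp K)^[n] v x := by
  induction n generalizing v with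
  | zero => rfl
  | succ n ih => simp_rw [Function.iterate_succ_apply, colOp_const_mul, ih]

theorem colOp_iterate_mono (n : ℕ) {v w : S → ℝ≥0∞} (h : ∀ x, v x ≤ w x) (x : S) :
    (colOp K)^[n] v x ≤ (colOp K)^[n] w x := by
  induction n generalizing v w x with
  | zero => exact h x
  | succ n ih => exact ih (colOp_mono K h) x

theorem indicator_singleton_tsum (v : S → ℝ≥0∞) :
    (fun x => ∑' y, v y * ({y} : Set S).indicator 1 x) = v := by
  ext x
  rw [tsum_eq_single x]
  · simp
  · intro y hy
    simp [hy.symm]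

theorem colOp_indicator (x y : S) : colOp K (({y} : Set S).indicator 1) x = K x y := by
  rw [colOp, tsum_eq_single y]
  · simp
  · intro z hz
    simp [hz]

end colOp

/-- The rigidity that turns domination of eigenvectors into equality. -/
theorem ENNReal.eq_of_le_of_tsum_le {ι : Type*} {f g : ι → ℝ≥0∞} (h : ∀ i, f i ≤ g i)
    (hs : ∑' i, g i ≤ ∑' i, f i) (hf : ∑' i, f i ≠ ∞) : f = g := by
  by_contra hne
  obtain ⟨i, hi⟩ := Function.ne_iff.1 hne
  exact (ENNReal.tsum_lt_tsum hf h (lt_of_le_of_ne (h i) hi)).not_ge hs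

theorem Matrix.IsIrreducible.induction {S : Type*} {B : S → S → ℝ≥0}
    (hirr : Matrix.IsIrreducible (Matrix.of fun x y : S => (B x y : ℝ))) {P : S → Prop} {x : S}
    (hx : P x) (hP : ∀ x y, P x → B x y ≠ 0 → P y) (y : S) : P y := by
  let : Quiver S := Matrix.toQuiver (Matrix.of fun x y : S => (B x y : ℝ))
  obtain ⟨p, -⟩ := hirr.connected x y
  induction p with
  | nil => exact hx
  | cons q e ih =>
    refine hP _ _ ih ?_
    have : (0 : ℝ) < B _ _ := e.down
    exact_mod_cast this.ne'

/-! ### Resolvent of `B̃` and eigenvectors of `B` -/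

namespace SplitMatrix

open SplitPath

variable {S : Type*} (M : SplitMatrix S)

theorem psi_tsum {ι : Type*} (f : ι → S → ℝ≥0∞) :
    M.psi (fun x => ∑' i, f i x) = ∑' i, M.psi (f i) := by
  simp_rw [psi, ← ENNReal.tsum_mul_left]
  exact ENNReal.tsum_comm

theorem psi_const_mul (c : ℝ≥0∞) (v : S → ℝ≥0∞) : M.psi (fun x => c * v x) = c * M.psi v := by
  simp_rw [psi, ← ENNReal.tsum_mul_left]
  exact tsum_congr fun y => by ring

theorem psi_add (v w : S → ℝ≥0∞) : M.psi (fun x => v x + w x) = M.psi v + M.psi w := by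
  simp_rw [psi, mul_add]
  exact ENNReal.tsum_add

theorem psi_one : M.psi 1 = 1 := by simp [psi, M.ψ.tsum_coe]

theorem psi_mono {v w : S → ℝ≥0∞} (h : ∀ x, v x ≤ w x) : M.psi v ≤ M.psi w :=
  ENNReal.tsum_le_tsum fun y => by gcongr; exact h y

theorem exists_ψ_pos : ∃ z, M.ψ z ≠ 0 := by
  obtain ⟨z, hz⟩ := M.ψ.support_nonempty
  exact ⟨z, hz⟩

theorem δ_ne_zero : (M.δ : ℝ≥0∞) ≠ 0 := by exact_mod_cast M.δ_pos.ne'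

theorem B_ne_zero_of_ψ {x y : S} (h : M.ψ y ≠ 0) : M.B x y ≠ 0 := by
  intro h0
  have := M.minorization x y
  rw [h0, ENNReal.coe_zero, nonpos_iff_eq_zero, mul_eq_zero] at this
  exact this.elim M.δ_ne_zero h

theorem colOp_Be (v : S → ℝ≥0∞) (x : S) :
    colOp M.Be v x = M.δ * M.psi v + colOp M.Btilde v x := by
  simp_rw [colOp, Be_eq, add_mul, ENNReal.tsum_add, psi, ← ENNReal.tsum_mul_left, mul_assoc]

theorem colOp_Be_one_le (x : S) : colOp M.Be 1 x ≤ 1 := by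
  simpa [colOp, Be] using M.subStochastic x

theorem colOp_Btilde_le (v : S → ℝ≥0∞) (x : S) : colOp M.Btilde v x ≤ colOp M.Be v x := by
  rw [colOp_Be]
  exact le_add_self

theorem iterate_Be_one_le (n : ℕ) (x : S) : (colOp M.Be)^[n] 1 x ≤ 1 := by
  induction n generalizing x with
  | zero => exact le_rfl
  | succ n ih =>
    rw [Function.iterate_succ_apply']
    exact (colOp_mono _ ih x).trans (M.colOp_Be_one_le x)

theorem iterate_Btilde_le (n : ℕ) (v : S → ℝ≥0∞) (x : S) :
    (colOp M.Btilde)^[n] v x ≤ (colOp M.Be)^[n] v x := by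
  induction n generalizing x with
  | zero => exact le_rfl
  | succ n ih =>
    rw [Function.iterate_succ_apply', Function.iterate_succ_apply']
    exact (M.colOp_Btilde_le _ x).trans (colOp_mono _ ih x)

/-- Decomposition of the powers of `B` according to the time `i + 1` of the first regeneration. -/
theorem iterate_Be (n : ℕ) (v : S → ℝ≥0∞) (x : S) :
    (colOp M.Be)^[n] v x = (colOp M.Btilde)^[n] v x + ∑ i ∈ Finset.range n,
      M.δ * (colOp M.Btilde)^[i] 1 x * M.psi ((colOp M.Be)^[n - 1 - i] v) := by
  induction n generalizing x with
  | zero => simp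
  | succ n ih =>
    have h : (colOp M.Be)^[n] v = fun x => (colOp M.Btilde)^[n] v x +
        ∑' i : Fin n, (M.δ * M.psi ((colOp M.Be)^[n - 1 - i] v)) *
          (colOp M.Btilde)^[(i : ℕ)] 1 x := by
      ext x
      rw [ih, tsum_fintype, Finset.sum_range]
      congr 1
      exact Finset.sum_congr rfl fun i _ => by ring
    rw [Function.iterate_succ_apply', colOp_Be, h, colOp_add, colOp_tsum, ← h]
    beta_reduce
    rw [tsum_fintype, Finset.sum_range_succ', Function.iterate_succ_apply', Finset.sum_range, add_comm, add_assoc]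
    congr 2
    · refine Finset.sum_congr rfl fun i _ => ?_
      rw [colOp_const_mul, Function.iterate_succ_apply']
      have : n + 1 - 1 - (↑i + 1) = n - 1 - i := by omega
      rw [this]
      ring
    · simp

/-- The resolvent of `B̃`, applied to a column vector. -/
noncomputable def green (r : ℝ≥0∞) (v : S → ℝ≥0∞) (x : S) : ℝ≥0∞ :=
  ∑' n : ℕ, r ^ n * (colOp M.Btilde)^[n] v x

theorem green_eq_add (r : ℝ≥0∞) (v : S → ℝ≥0∞) (x : S) :
    M.green r v x = v x + r * M.green r (colOp M.Btilde v) x := by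
  rw [green, tsum_eq_zero_add' ENNReal.summable, green, ← ENNReal.tsum_mul_left]
  simp_rw [Function.iterate_succ_apply, pow_succ]
  simp only [pow_zero, Function.iterate_zero, id, one_mul]
  congr 1
  exact tsum_congr fun n => by ring

theorem colOp_green (r : ℝ≥0∞) (v : S → ℝ≥0∞) (x : S) :
    colOp M.Btilde (M.green r v) x = M.green r (colOp M.Btilde v) x := by
  have : M.green r v = fun x => ∑' n : ℕ, r ^ n * (colOp M.Btilde)^[n] v x := rfl
  rw [this, colOp_tsum, green]
  refine tsum_congr fun n => ?_
  rw [colOp_const_mul, ← Function.iterate_succ_apply' (colOp M.Btilde),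
    Function.iterate_succ_apply (colOp M.Btilde)]

/-- The mass of `ψ B̃ ^ n`. -/
noncomputable def tabooMass (n : ℕ) : ℝ≥0∞ := M.psi ((colOp M.Btilde)^[n] 1)

theorem tabooMass_zero : M.tabooMass 0 = 1 := M.psi_one

theorem psi_green (r : ℝ≥0∞) (v : S → ℝ≥0∞) :
    M.psi (M.green r v) = ∑' n : ℕ, r ^ n * M.psi ((colOp M.Btilde)^[n] v) := by
  unfold green
  simp_rw [psi_tsum, psi_const_mul]

theorem green_tsum {ι : Type*} (r : ℝ≥0∞) (f : ι → S → ℝ≥0∞) (x : S) :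
    M.green r (fun x => ∑' i, f i x) x = ∑' i, M.green r (f i) x := by
  simp_rw [green, colOp_iterate_tsum, ← ENNReal.tsum_mul_left]
  exact ENNReal.tsum_comm

theorem green_const_mul (r c : ℝ≥0∞) (v : S → ℝ≥0∞) (x : S) :
    M.green r (fun x => c * v x) x = c * M.green r v x := by
  simp_rw [green, colOp_iterate_const_mul, ← ENNReal.tsum_mul_left]
  exact tsum_congr fun n => by ring

/-- The column vector `r δ (1 - r B̃)⁻¹ 1`. -/
noncomputable def colVec (r : ℝ≥0∞) (x : S) : ℝ≥0∞ := r * M.δ * M.green r 1 x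

/-- The row vector `ψ (1 - r B̃)⁻¹`. -/
noncomputable def rowVec (r : ℝ≥0∞) (y : S) : ℝ≥0∞ :=
  M.psi (M.green r (({y} : Set S).indicator 1))

/-- By linearity it suffices to test point masses. Through this pairing all row computations are
done with column vectors. -/
theorem tsum_rowVec_mul (r : ℝ≥0∞) (v : S → ℝ≥0∞) :
    ∑' y, M.rowVec r y * v y = M.psi (M.green r v) := by
  conv_rhs => rw [← indicator_singleton_tsum v]
  have : M.green r (fun x => ∑' y, v y * ({y} : Set S).indicator 1 x) =
      fun x => ∑' y, v y * M.green r (({y} : Set S).indicator 1) x := by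
    ext x
    rw [green_tsum]
    exact tsum_congr fun y => M.green_const_mul _ _ _ _
  rw [this, psi_tsum]
  exact tsum_congr fun y => by rw [psi_const_mul, mul_comm]; rfl

theorem psi_colVec (r : ℝ≥0∞) : M.psi (M.colVec r) = r * M.δ * M.psi (M.green r 1) :=
  M.psi_const_mul _ _

theorem tsum_rowVec (r : ℝ≥0∞) : ∑' y, M.rowVec r y = M.psi (M.green r 1) := by
  rw [← tsum_rowVec_mul]
  simp

section eigen

variable {M} {r : ℝ≥0∞} (hr0 : r ≠ 0) (hr : r ≠ ∞) (h1 : M.psi (M.colVec r) = 1)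

include hr0 hr h1

/-- Applying B̃ shifts the resolvent series and loses its zeroth term; the rank-one part δψ(u)1 = δ1
restores exactly that term. -/
theorem colOp_Be_colVec (x : S) : colOp M.Be (M.colVec r) x = r⁻¹ * M.colVec r x := by
  have : M.colVec r = fun x => r * M.δ * M.green r 1 x := rfl
  rw [colOp_Be, h1, this, colOp_const_mul]
  beta_reduce
  rw [colOp_green, green_eq_add _ _ 1 x, Pi.one_apply, ← mul_assoc, ← mul_assoc, ENNReal.inv_mul_cancel hr0 hr]
  ring

theorem tsum_rowVec_mul_Be (y : S) :
    ∑' x, M.rowVec r x * M.Be x y = r⁻¹ * M.rowVec r y := by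
  have hB : (fun x => M.Be x y) = colOp M.Be (({y} : Set S).indicator 1) := by
    ext x
    rw [colOp_indicator]
  have h2 := M.tsum_rowVec_mul r (fun x => M.Be x y)
  rw [h2, hB]
  -- The two summands are indexed by `Bool` so that `green_tsum` yields additivity.
  have hB' : colOp M.Be (({y} : Set S).indicator 1) = fun x =>
      ∑' b : Bool, bif b then (M.δ * M.psi (({y} : Set S).indicator 1)) * (1 : S → ℝ≥0∞) x
        else colOp M.Btilde (({y} : Set S).indicator 1) x := by
    ext x
    rw [colOp_Be, tsum_fintype]
    simp
  have h3 : M.green r (colOp M.Be (({y} : Set S).indicator 1)) = fun x =>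
      (M.δ * M.psi (({y} : Set S).indicator 1)) * M.green r 1 x +
        M.green r (colOp M.Btilde (({y} : Set S).indicator 1)) x := by
    ext x
    rw [hB', green_tsum, tsum_fintype, Fintype.sum_bool]
    simp only [cond_true, cond_false]
    rw [green_const_mul]
  rw [h3, psi_add, psi_const_mul]
  have h4 : M.rowVec r y = M.psi (({y} : Set S).indicator 1) +
      r * M.psi (M.green r (colOp M.Btilde (({y} : Set S).indicator 1))) := by
    rw [← psi_const_mul, ← psi_add, rowVec]
    congr 1
    ext x
    rw [green_eq_add]
  rw [psi_colVec] at h1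
  rw [h4, mul_add, ← mul_assoc, ENNReal.inv_mul_cancel hr0 hr, one_mul]
  congr 1
  calc M.δ * M.psi (({y} : Set S).indicator 1) * M.psi (M.green r 1)
      = r⁻¹ * r * (M.δ * M.psi (({y} : Set S).indicator 1) * M.psi (M.green r 1)) := by
        rw [ENNReal.inv_mul_cancel hr0 hr, one_mul]
    _ = r⁻¹ * (r * M.δ * M.psi (M.green r 1)) * M.psi (({y} : Set S).indicator 1) := by ring
    _ = _ := by rw [h1, mul_one]

omit h1 hr in
theorem colVec_pos (x : S) : 0 < M.colVec r x := by
  rw [pos_iff_ne_zero, colVec, green_eq_add]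
  simp [hr0, M.δ_ne_zero]

/-- Finiteness holds where ψ > 0, because ψ(u) = 1, and spreads along edges by B(x, y)u(y) ≤
r⁻¹u(x). -/
theorem colVec_lt_top (hirr : Matrix.IsIrreducible (Matrix.of fun x y : S => (M.B x y : ℝ)))
    (x : S) : M.colVec r x < ∞ := by
  obtain ⟨z, hz⟩ := M.exists_ψ_pos
  refine hirr.induction (P := fun x => M.colVec r x < ∞) (x := z) ?_ ?_ x
  · by_contra hc
    have hle : M.ψ z * M.colVec r z ≤ 1 := by
      rw [← h1, psi]
      exact ENNReal.le_tsum z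
    rw [not_lt_top_iff.1 hc, ENNReal.mul_top hz] at hle
    simp at hle
  · intro x y hx hB
    by_contra hc
    have hle : M.Be x y * M.colVec r y ≤ r⁻¹ * M.colVec r x := by
      rw [← colOp_Be_colVec hr0 hr h1]
      exact ENNReal.le_tsum y
    rw [not_lt_top_iff.1 hc, ENNReal.mul_top (by simpa [Be] using hB), top_le_iff] at hle
    exact ENNReal.mul_ne_top (by simpa using hr0) hx.ne hle

omit hr in
theorem rowVec_lt_top (y : S) : M.rowVec r y < ∞ := by
  have : M.rowVec r y ≤ M.psi (M.green r 1) := by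
    rw [← tsum_rowVec]
    exact ENNReal.le_tsum y
  refine this.trans_lt ?_
  rw [psi_colVec] at h1
  by_contra hc
  rw [not_lt_top_iff.1 hc, ENNReal.mul_top (mul_ne_zero hr0 M.δ_ne_zero)] at h1
  simp at h1

theorem rowVec_pos (hirr : Matrix.IsIrreducible (Matrix.of fun x y : S => (M.B x y : ℝ)))
    (y : S) : 0 < M.rowVec r y := by
  obtain ⟨z, hz⟩ := M.exists_ψ_pos
  refine hirr.induction (P := fun x => 0 < M.rowVec r x) (x := z) ?_ ?_ y
  · rw [pos_iff_ne_zero]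
    intro h0
    rw [rowVec, psi, ENNReal.tsum_eq_zero] at h0
    specialize h0 z
    rw [green_eq_add] at h0
    simp [hz] at h0
  · intro x y hx hB
    have hle : M.rowVec r x * M.Be x y ≤ r⁻¹ * M.rowVec r y := by
      rw [← tsum_rowVec_mul_Be hr0 hr h1]
      exact ENNReal.le_tsum x
    rw [pos_iff_ne_zero]
    intro h0
    rw [h0, mul_zero, nonpos_iff_eq_zero, mul_eq_zero] at hle
    exact hle.elim hx.ne' (by simpa [Be] using hB)

/-- With d = ψ(u), iterating u = rδd1 + rB̃u gives u ≥ d·`colVec`. Both sides have ψ-mass d, so they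
agree where ψ > 0. If they agree at x, their images under B agree at x, so they agree at every y
with B(x, y) > 0. -/
theorem eq_mul_colVec (hirr : Matrix.IsIrreducible (Matrix.of fun x y : S => (M.B x y : ℝ)))
    {u : S → ℝ≥0} (hpos : ∀ x, 0 < u x)
    (hu : ∀ x, colOp M.Be (fun y => u y) x = r⁻¹ * u x) :
    ∃ c : ℝ≥0, 0 < c ∧ ∀ x, (u x : ℝ≥0∞) = c * M.colVec r x := by
  obtain ⟨z, hz⟩ := M.exists_ψ_pos
  set d := M.psi fun y => u y with hd
  have hri : r⁻¹ ≠ ∞ := by simpa using hr0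
  have hd_top : d ≠ ∞ := by
    intro hc
    have := hu z
    rw [colOp_Be, ← hd, hc, ENNReal.mul_top M.δ_ne_zero, top_add] at this
    exact ENNReal.mul_ne_top hri ENNReal.coe_ne_top this.symm
  have hd0 : d ≠ 0 := by
    rw [hd, psi, Ne, ENNReal.tsum_eq_zero]
    push Not
    exact ⟨z, mul_ne_zero hz (by exact_mod_cast (hpos z).ne')⟩
  have hu' (x : S) : (u x : ℝ≥0∞) = r * M.δ * d + r * colOp M.Btilde (fun y => u y) x := by
    have := hu x
    rw [colOp_Be] at this
    rw [mul_assoc, ← mul_add, this, ← mul_assoc, ENNReal.mul_inv_cancel hr0 hr, one_mul]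
  have hpart (N : ℕ) (x : S) : ∑ n ∈ Finset.range N,
      r * M.δ * d * (r ^ n * (colOp M.Btilde)^[n] 1 x) ≤ u x := by
    induction N generalizing x with
    | zero => simp
    | succ N ih =>
      rw [Finset.sum_range_succ', hu' x, add_comm]
      gcongr ?_ + ?_
      · simp
      · calc ∑ n ∈ Finset.range N, r * M.δ * d * (r ^ (n + 1) * (colOp M.Btilde)^[n + 1] 1 x)
            = r * colOp M.Btilde (fun x => ∑' n : Fin N,
              (r * M.δ * d * r ^ (n : ℕ)) * (colOp M.Btilde)^[n] 1 x) x := by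
              simp_rw [colOp_tsum, colOp_const_mul, tsum_fintype, Finset.sum_range, Finset.mul_sum,
                ← Function.iterate_succ_apply' (colOp M.Btilde)]
              exact Finset.sum_congr rfl fun n _ => by ring
          _ ≤ _ := by
              gcongr
              refine colOp_mono _ (fun x => ?_) x
              refine le_trans (le_of_eq ?_) (ih x)
              rw [tsum_fintype, Finset.sum_range]
              exact Finset.sum_congr rfl fun n _ => by ring
  have hle (x : S) : d * M.colVec r x ≤ u x := by
    have : d * M.colVec r x = ∑' n, r * M.δ * d * (r ^ n * (colOp M.Btilde)^[n] 1 x) := by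
      rw [ENNReal.tsum_mul_left, colVec, green]
      ring
    rw [this]
    exact ENNReal.tsum_le_of_sum_range_le fun N => hpart N x
  have heq : ∀ x, (u x : ℝ≥0∞) = d * M.colVec r x := by
    refine hirr.induction (x := z) ?_ ?_
    · have := ENNReal.eq_of_le_of_tsum_le (f := fun x => M.ψ x * (d * M.colVec r x))
        (g := fun x => M.ψ x * u x) (fun x => by gcongr; exact hle x)
        (by
          change d ≤ M.psi _
          rw [psi_const_mul, h1, mul_one])
        (by
          change M.psi _ ≠ _
          rwa [psi_const_mul, h1, mul_one])
      have := congrFun this z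
      exact ((ENNReal.mul_right_inj hz (M.ψ.apply_ne_top z)).1 this).symm
    · intro x y hx hB
      have h2 : colOp M.Be (fun x => d * M.colVec r x) x = r⁻¹ * u x := by
        rw [colOp_const_mul]
        beta_reduce
        rw [colOp_Be_colVec hr0 hr h1, hx]
        ring
      have := ENNReal.eq_of_le_of_tsum_le (f := fun y => M.Be x y * (d * M.colVec r y))
        (g := fun y => M.Be x y * u y) (fun y => by gcongr; exact hle y)
        (by
          change colOp M.Be _ x ≤ colOp M.Be _ x
          rw [h2, hu])
        (by
          change colOp M.Be _ x ≠ _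
          rw [h2]
          exact ENNReal.mul_ne_top hri ENNReal.coe_ne_top)
      have := congrFun this y
      exact ((ENNReal.mul_right_inj (by simpa [Be] using hB) (by simp [Be])).1 this).symm
  refine ⟨d.toNNReal, ENNReal.toNNReal_pos hd0 hd_top, fun x => ?_⟩
  rw [heq, ENNReal.coe_toNNReal hd_top]

/-- The minorization makes s = ∑ η finite. Iteration gives η ≥ rδs·`rowVec`, and F(r) = 1 gives both
sides total mass s, so equality holds everywhere at once. -/
theorem eq_mul_rowVec {η : S → ℝ≥0} (hpos : ∀ y, 0 < η y)
    (hη : ∀ y, ∑' x, (η x : ℝ≥0∞) * M.Be x y = r⁻¹ * η y) :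
    ∃ c : ℝ≥0, 0 < c ∧ ∀ y, (η y : ℝ≥0∞) = c * M.rowVec r y := by
  obtain ⟨z, hz⟩ := M.exists_ψ_pos
  set s := ∑' x, (η x : ℝ≥0∞) with hs
  have hri : r⁻¹ ≠ ∞ := by simpa using hr0
  have hs_top : s ≠ ∞ := by
    intro hc
    have hle : s * (M.δ * M.ψ z) ≤ r⁻¹ * η z := by
      rw [← hη, hs, ← ENNReal.tsum_mul_right]
      exact ENNReal.tsum_le_tsum fun x => by gcongr; exact M.minorization x z
    rw [hc, ENNReal.top_mul (mul_ne_zero M.δ_ne_zero hz), top_le_iff] at hle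
    exact ENNReal.mul_ne_top hri ENNReal.coe_ne_top hle
  have hs0 : s ≠ 0 := by
    rw [hs, Ne, ENNReal.tsum_eq_zero]
    push Not
    exact ⟨z, by exact_mod_cast (hpos z).ne'⟩
  -- The row equation in weak form, tested against v, so that it can be iterated by moving B̃ onto
  -- v.
  have hpair (v : S → ℝ≥0∞) : ∑' x, (η x : ℝ≥0∞) * v x =
      r * M.δ * s * M.psi v + r * ∑' x, (η x : ℝ≥0∞) * colOp M.Btilde v x := by
    have h2 : ∑' x, (η x : ℝ≥0∞) * colOp M.Be v x = r⁻¹ * ∑' y, (η y : ℝ≥0∞) * v y := by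
      simp_rw [colOp, ← ENNReal.tsum_mul_left, ← mul_assoc, ← hη, ← ENNReal.tsum_mul_right]
      exact ENNReal.tsum_comm
    have h3 : ∑' x, (η x : ℝ≥0∞) * v x = r * ∑' x, (η x : ℝ≥0∞) * colOp M.Be v x := by
      rw [h2, ← mul_assoc, ENNReal.mul_inv_cancel hr0 hr, one_mul]
    rw [h3]
    simp_rw [colOp_Be, mul_add, ENNReal.tsum_add, mul_add, ENNReal.tsum_mul_right]
    ring
  have hpart (N : ℕ) (v : S → ℝ≥0∞) : ∑ n ∈ Finset.range N,
      r * M.δ * s * (r ^ n * M.psi ((colOp M.Btilde)^[n] v)) ≤ ∑' x, (η x : ℝ≥0∞) * v x := by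
    induction N generalizing v with
    | zero => simp
    | succ N ih =>
      rw [Finset.sum_range_succ', hpair v, add_comm]
      gcongr ?_ + ?_
      · simp
      · refine le_trans (le_of_eq ?_) (mul_le_mul_right (ih (colOp M.Btilde v)) r)
        rw [Finset.mul_sum]
        refine Finset.sum_congr rfl fun n _ => ?_
        rw [Function.iterate_succ_apply]
        ring
  have hle (y : S) : r * M.δ * s * M.rowVec r y ≤ η y := by
    have h2 : (η y : ℝ≥0∞) = ∑' x, (η x : ℝ≥0∞) * ({y} : Set S).indicator 1 x := by
      rw [tsum_eq_single y]
      · simp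
      · intro x hx
        simp [hx]
    rw [h2, rowVec, psi_green, ← ENNReal.tsum_mul_left]
    exact ENNReal.tsum_le_of_sum_range_le fun N => hpart N _
  have hsum : ∑' y, r * M.δ * s * M.rowVec r y = s := by
    rw [ENNReal.tsum_mul_left, tsum_rowVec]
    rw [psi_colVec] at h1
    calc _ = (r * M.δ * M.psi (M.green r 1)) * s := by ring
      _ = s := by rw [h1, one_mul]
  have heq := ENNReal.eq_of_le_of_tsum_le hle hsum.ge (by rwa [hsum])
  have hc : r * M.δ * s ≠ ∞ := ENNReal.mul_ne_top (ENNReal.mul_ne_top hr ENNReal.coe_ne_top) hs_top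
  refine ⟨(r * M.δ * s).toNNReal, ENNReal.toNNReal_pos
    (mul_ne_zero (mul_ne_zero hr0 M.δ_ne_zero) hs0) hc, fun y => ?_⟩
  rw [ENNReal.coe_toNNReal hc]
  exact (congrFun heq y).symm

end eigen

end SplitMatrix

/-! ### The discrete renewal theorem -/

section renewal

open Filter

/-- Dominated convergence for convolutions, over an arbitrary filter so that it also serves along an
ultrafilter. -/
theorem tendsto_sum_mul_shift {α : Type*} {l : Filter α} {N : α → ℕ} (hN : Tendsto N l atTop)
    {c b ℓ : ℕ → ℝ} {C : ℝ} (hc : Summable fun i => |c i|) (hb : ∀ n, |b n| ≤ C)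
    (hℓ : ∀ i, Tendsto (fun n => b (N n - i)) l (𝓝 (ℓ i))) :
    Tendsto (fun n => ∑ i ∈ Finset.range (N n + 1), c i * b (N n - i)) l
      (𝓝 (∑' i, c i * ℓ i)) := by
  have h : Tendsto (fun n => ∑' i, if i < N n + 1 then c i * b (N n - i) else 0) l
      (𝓝 (∑' i, c i * ℓ i)) := by
    refine tendsto_tsum_of_dominated_convergence (hc.mul_right C) (fun i => ?_)
      (Eventually.of_forall fun n i => ?_)
    · refine ((hℓ i).const_mul (c i)).congr' ?_
      filter_upwards [hN.eventually_ge_atTop i] with n hn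
      rw [if_pos (by omega)]
    · split_ifs
      · rw [Real.norm_eq_abs, abs_mul]
        exact mul_le_mul_of_nonneg_left (hb _) (abs_nonneg _)
      · rw [norm_zero]
        exact mul_nonneg (abs_nonneg _) ((abs_nonneg _).trans (hb 0))
  refine h.congr fun n => ?_
  rw [tsum_eq_sum (s := Finset.range (N n + 1))]
  · exact Finset.sum_congr rfl fun i hi => if_pos (Finset.mem_range.1 hi)
  · intro i hi
    exact if_neg (by simpa using hi)

/-- In a solution of the renewal equation, the overshoot functional is conserved. -/
theorem renewal_sum_tail {f a b q : ℕ → ℝ} (hq0 : q 0 = 1) (hq : ∀ i, q i = f i + q (i + 1))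
    (hb : ∀ n, b n = a n + ∑ i ∈ Finset.range n, f i * b (n - 1 - i)) (n : ℕ) :
    ∑ i ∈ Finset.range (n + 1), q i * b (n - i) = ∑ k ∈ Finset.range (n + 1), a k := by
  induction n with
  | zero =>
    have := hb 0
    rw [Finset.range_zero, Finset.sum_empty, add_zero] at this
    simp [hq0, this]
  | succ n ih =>
    rw [Finset.sum_range_succ', Finset.sum_range_succ _ (n + 1), ← ih, hq0, Nat.sub_zero,
      hb (n + 1)]
    have : ∀ i ∈ Finset.range (n + 1), q i * b (n - i) =
        q (i + 1) * b (n + 1 - (i + 1)) + f i * b (n + 1 - 1 - i) := by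
      intro i _
      rw [hq i, Nat.add_sub_add_right, Nat.add_sub_cancel]
      ring
    rw [Finset.sum_congr rfl this, Finset.sum_add_distrib]
    ring

/-- Along an ultrafilter realizing L = limsup b, every shift b(n - j) has a limit ℓ j ≤ L. The
renewal equation makes ℓ m an f-average of later ℓ's, so the maximum L propagates. The conserved sum
∑ q i · b(n - i) then gives Lμ = A. -/
theorem renewal_eventually_lt {f a b q : ℕ → ℝ} {A C μ : ℝ} (hf0 : 0 < f 0) (hf : ∀ i, 0 ≤ f i)
    (hf1 : HasSum f 1) (hq0 : q 0 = 1) (hq : ∀ i, q i = f i + q (i + 1)) (hqnn : ∀ i, 0 ≤ q i)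
    (hμ : HasSum q μ) (ha : HasSum a A) (hbC : ∀ n, |b n| ≤ C)
    (hb : ∀ n, b n = a n + ∑ i ∈ Finset.range n, f i * b (n - 1 - i)) {c : ℝ} (hc : A / μ < c) :
    ∀ᶠ n in atTop, b n < c := by
  have hμ0 : 0 < μ := by
    have := le_hasSum hμ 0 fun i _ => hqnn i
    linarith
  have hbd : IsBoundedUnder (· ≤ ·) atTop b :=
    isBoundedUnder_of ⟨C, fun n => (abs_le.1 (hbC n)).2⟩
  have hbd' : IsBoundedUnder (· ≥ ·) atTop b :=
    isBoundedUnder_of ⟨-C, fun n => (abs_le.1 (hbC n)).1⟩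
  set L := limsup b atTop with hL
  suffices hLA : L * μ = A from
    eventually_lt_of_limsup_lt (by rwa [← hL, (eq_div_iff hμ0.ne').2 hLA]) hbd
  have hcl : MapClusterPt L atTop b := MapClusterPt.limsup hbd'.isCoboundedUnder_flip hbd
  obtain ⟨U, hU, hUL⟩ := mapClusterPt_iff_ultrafilter.1 hcl
  have hsub (j : ℕ) : Tendsto (fun n => n - j) (U : Filter ℕ) atTop :=
    (tendsto_sub_atTop_nat j).mono_left hU
  have hex (j : ℕ) : ∃ x, Tendsto (fun n => b (n - j)) U (𝓝 x) := by
    obtain ⟨x, -, hx⟩ := (isCompact_Icc (a := -C) (b := C)).ultrafilter_le_nhds'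
      (U.map fun n => b (n - j)) (Ultrafilter.mem_map.2
        (Filter.univ_mem' fun n => abs_le.1 (hbC (n - j))))
    exact ⟨x, hx⟩
  choose ℓ hℓ using hex
  have hℓL (j : ℕ) : ℓ j ≤ L := by
    have : MapClusterPt (ℓ j) atTop b := by
      refine mapClusterPt_iff_ultrafilter.2 ⟨U.map fun n => n - j, hsub j, ?_⟩
      exact hℓ j
    exact this.le_limsup hbd
  have hℓC (j : ℕ) : |ℓ j| ≤ C := le_of_tendsto (hℓ j).abs (Eventually.of_forall fun n => hbC _)
  have habs : Summable fun i => |f i| := by simpa [abs_of_nonneg (hf _)] using hf1.summable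
  have hrec (m : ℕ) : ℓ m = ∑' i, f i * ℓ (m + 1 + i) := by
    have h1 := tendsto_sum_mul_shift (hsub (m + 1)) habs hbC (ℓ := fun i => ℓ (m + 1 + i))
      (fun i => by simpa [Nat.sub_sub] using hℓ (m + 1 + i))
    have h2 : Tendsto (fun n => a (n - m)) U (𝓝 0) :=
      ha.summable.tendsto_atTop_zero.comp (hsub m)
    have h3 := h2.add h1
    rw [zero_add] at h3
    refine tendsto_nhds_unique (hℓ m) (h3.congr' ?_)
    filter_upwards [hU (eventually_ge_atTop (m + 1))] with n hn
    rw [hb (n - m)]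
    have h4 : n - (m + 1) + 1 = n - m := by omega
    have h5 : n - (m + 1) = n - m - 1 := by omega
    rw [h4, h5]
  -- If an average of values at most L equals L, every value of positive weight is L; `f 0 > 0`
  -- gives the next one.
  have hall (m : ℕ) : ℓ m = L := by
    induction m with
    | zero => exact tendsto_nhds_unique (hℓ 0) hUL
    | succ m ih =>
      have hs : Summable fun i => f i * ℓ (m + 1 + i) :=
        Summable.of_norm_bounded (hf1.summable.mul_right C) fun i => by
          rw [Real.norm_eq_abs, abs_mul, abs_of_nonneg (hf i)]
          exact mul_le_mul_of_nonneg_left (hℓC _) (hf i)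
      have h1 : HasSum (fun i => f i * L - f i * ℓ (m + 1 + i)) 0 := by
        have := (hf1.mul_right L).sub hs.hasSum
        rwa [← hrec, ih, one_mul, sub_self] at this
      have h2 := (hasSum_zero_iff_of_nonneg fun i => by
        rw [← mul_sub]
        exact mul_nonneg (hf i) (sub_nonneg.2 (hℓL _))).1 h1
      have h3 := congrFun h2 0
      simp only [← mul_sub, add_zero, Pi.zero_apply, mul_eq_zero, hf0.ne', false_or] at h3
      linarith
  have h1 := tendsto_sum_mul_shift (N := fun n => n) (l := U) (hsub 0) (c := q)
    (by simpa only [abs_of_nonneg (hqnn _)] using hμ.summable) hbC hℓ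
  simp_rw [hall, tsum_mul_right, hμ.tsum_eq, renewal_sum_tail hq0 hq hb] at h1
  have h2 : Tendsto (fun n => ∑ k ∈ Finset.range (n + 1), a k) U (𝓝 A) :=
    (ha.tendsto_sum_nat.comp (tendsto_add_atTop_nat 1)).mono_left hU
  rw [mul_comm]
  exact tendsto_nhds_unique h1 h2

/-- The renewal theorem of Erdős, Feller and Pollard, for increments that take the value `1` with
positive probability. -/
theorem renewal_tendsto {f a b q : ℕ → ℝ} {A C μ : ℝ} (hf0 : 0 < f 0) (hf : ∀ i, 0 ≤ f i)
    (hf1 : HasSum f 1) (hq0 : q 0 = 1) (hq : ∀ i, q i = f i + q (i + 1)) (hqnn : ∀ i, 0 ≤ q i)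
    (hμ : HasSum q μ) (ha : HasSum a A) (hbC : ∀ n, |b n| ≤ C)
    (hb : ∀ n, b n = a n + ∑ i ∈ Finset.range n, f i * b (n - 1 - i)) :
    Tendsto b atTop (𝓝 (A / μ)) := by
  refine tendsto_order.2 ⟨fun c hc => ?_, fun c hc =>
    renewal_eventually_lt hf0 hf hf1 hq0 hq hqnn hμ ha hbC hb hc⟩
  -- The equation is linear and no sign was imposed on a or b, so the lower bound is the upper bound
  -- for -b.
  have := renewal_eventually_lt (b := fun n => -b n) (a := fun n => -a n) (c := -c)
    hf0 hf hf1 hq0 hq hqnn hμ ha.neg (fun n => by rw [abs_neg]; exact hbC n) (fun n => by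
      rw [hb n]
      simp only [mul_neg, Finset.sum_neg_distrib]
      ring) (by rw [neg_div]; exact neg_lt_neg hc)
  filter_upwards [this] with n hn
  exact neg_lt_neg_iff.1 hn

end renewal

/-! ### Cycle weights: existence of θ and summability -/

namespace SplitMatrix

open SplitPath Filter

variable {S : Type*} (M : SplitMatrix S)

/-- The weight of a cycle of length `n + 1` between regenerations. -/
noncomputable def cycleWeight (r : ℝ≥0∞) (n : ℕ) : ℝ≥0∞ := r ^ (n + 1) * (M.δ * M.tabooMass n)

theorem psi_colVec_eq_tsum (r : ℝ≥0∞) : M.psi (M.colVec r) = ∑' n, M.cycleWeight r n := by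
  rw [psi_colVec, psi_green, ← ENNReal.tsum_mul_left]
  refine tsum_congr fun n => ?_
  rw [cycleWeight, tabooMass]
  ring

theorem psi_iterate_Be (n : ℕ) (v : S → ℝ≥0∞) :
    M.psi ((colOp M.Be)^[n] v) = M.psi ((colOp M.Btilde)^[n] v) + ∑ i ∈ Finset.range n,
      M.δ * M.tabooMass i * M.psi ((colOp M.Be)^[n - 1 - i] v) := by
  have h : (colOp M.Be)^[n] v = fun x => (colOp M.Btilde)^[n] v x +
      ∑' i : Fin n, (M.δ * M.psi ((colOp M.Be)^[n - 1 - i] v)) *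
        (colOp M.Btilde)^[(i : ℕ)] 1 x := by
    ext x
    rw [iterate_Be, tsum_fintype, Finset.sum_range]
    congr 1
    exact Finset.sum_congr rfl fun i _ => by ring
  conv_lhs => rw [h, psi_add, psi_tsum, tsum_fintype]
  rw [Finset.sum_range]
  congr 1
  refine Finset.sum_congr rfl fun i _ => ?_
  rw [psi_const_mul, tabooMass]
  ring

theorem pow_mul_psi_iterate_Be (r : ℝ≥0∞) (n : ℕ) (v : S → ℝ≥0∞) :
    r ^ n * M.psi ((colOp M.Be)^[n] v) = r ^ n * M.psi ((colOp M.Btilde)^[n] v) +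
      ∑ i ∈ Finset.range n, M.cycleWeight r i *
        (r ^ (n - 1 - i) * M.psi ((colOp M.Be)^[n - 1 - i] v)) := by
  rw [psi_iterate_Be, mul_add, Finset.mul_sum]
  congr 1
  refine Finset.sum_congr rfl fun i hi => ?_
  have : n = (i + 1) + (n - 1 - i) := by
    have := Finset.mem_range.1 hi
    omega
  conv_lhs => enter [1]; rw [this, pow_add]
  rw [cycleWeight]
  ring

theorem pow_mul_iterate_Be (r : ℝ≥0∞) (n : ℕ) (v : S → ℝ≥0∞) (x : S) :
    r ^ n * (colOp M.Be)^[n] v x = r ^ n * (colOp M.Btilde)^[n] v x +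
      ∑ i ∈ Finset.range n, (r * M.δ * (r ^ i * (colOp M.Btilde)^[i] 1 x)) *
        (r ^ (n - 1 - i) * M.psi ((colOp M.Be)^[n - 1 - i] v)) := by
  rw [iterate_Be, mul_add, Finset.mul_sum]
  congr 1
  refine Finset.sum_congr rfl fun i hi => ?_
  have : n = (i + 1) + (n - 1 - i) := by
    have := Finset.mem_range.1 hi
    omega
  conv_lhs => enter [1]; rw [this, pow_add]
  ring

/-- If the regeneration cycles have total weight less than one, then the powers of `B` are
summable. -/
theorem tsum_pow_mul_psi_Be_lt_top {r : ℝ≥0∞} (hk : M.psi (M.green r 1) ≠ ∞)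
    (h1 : M.psi (M.colVec r) < 1) : ∑' n, r ^ n * M.psi ((colOp M.Be)^[n] 1) < ∞ := by
  set F := M.psi (M.colVec r) with hF
  set k := M.psi (M.green r 1) with hkdef
  -- The bound k / (1 - F) is the fixed point of t ↦ k + Ft, so it survives the induction over
  -- partial sums.
  have hC : k / (1 - F) = k + F * (k / (1 - F)) := by
    have h0 : 1 - F ≠ 0 := (tsub_pos_of_lt h1).ne'
    have ht : 1 - F ≠ ∞ := ENNReal.sub_ne_top ENNReal.one_ne_top
    calc k / (1 - F) = ((1 - F) + F) * (k / (1 - F)) := by rw [tsub_add_cancel_of_le h1.le, one_mul]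
      _ = _ := by rw [add_mul, ENNReal.mul_div_cancel h0 ht]
  have hN (N : ℕ) : ∑ n ∈ Finset.range N, r ^ n * M.psi ((colOp M.Be)^[n] 1) ≤ k / (1 - F) := by
    induction N with
    | zero => simp
    | succ N ih =>
      rw [Finset.sum_congr rfl fun n _ => M.pow_mul_psi_iterate_Be r n 1,
        Finset.sum_add_distrib, hC]
      gcongr ?_ + ?_
      · rw [hkdef, psi_green]
        exact ENNReal.sum_le_tsum _
      · rw [Finset.sum_range_succ']
        simp only [Nat.add_sub_cancel, Finset.range_zero, Finset.sum_empty, add_zero]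
        rw [Finset.sum_range_diag_flip N fun i j => M.cycleWeight r i *
          (r ^ j * M.psi ((colOp M.Be)^[j] 1))]
        calc _ ≤ ∑ i ∈ Finset.range N, M.cycleWeight r i * (k / (1 - F)) := by
              refine Finset.sum_le_sum fun i _ => ?_
              rw [← Finset.mul_sum]
              gcongr
              refine le_trans (Finset.sum_le_sum_of_subset ?_) ih
              exact Finset.range_mono (Nat.sub_le _ _)
          _ ≤ _ := by
              rw [← Finset.sum_mul, hF, psi_colVec_eq_tsum]
              gcongr
              exact ENNReal.sum_le_tsum _
  exact (ENNReal.tsum_le_of_sum_range_le hN).trans_lt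
    (ENNReal.div_lt_top hk (tsub_pos_of_lt h1).ne')

theorem uStar_eq_colVec [Countable S] (θ : ℝ) :
    M.uStar θ = M.colVec (ENNReal.ofReal (Real.exp θ)) := by
  ext x
  rw [uStar_eq, colVec, green, ← ENNReal.tsum_mul_left]
  exact tsum_congr fun n => by ring

theorem ηStar_eq_rowVec [Countable S] (θ : ℝ) :
    M.ηStar θ = M.rowVec (ENNReal.ofReal (Real.exp θ)) := by
  ext y
  rw [ηStar_eq]
  rfl

theorem expectPsi_regenWeight [Countable S] (θ : ℝ) : M.expectPsi (regenWeight θ) =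
    M.psi (M.colVec (ENNReal.ofReal (Real.exp θ))) := by
  rw [← uStar_eq_colVec]
  rfl

theorem expectPsi_expTime_T [Countable S] {θ : ℝ} (hθ : 0 < θ) :
    M.expectPsi (fun ω => expTime θ (T ω)) = 1 + (ENNReal.ofReal (Real.exp θ) - 1) *
      ∑' n : ℕ, ENNReal.ofReal (Real.exp θ) ^ n * M.psi ((colOp M.Be)^[n] 1) := by
  have h : M.expectPsi (fun ω => expTime θ (T ω)) =
      M.psi fun x => M.expect x (fun ω => expTime θ (T ω)) := rfl
  have h1 := M.psi_one
  rw [h]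
  simp_rw [M.expect_expTime_T hθ, psi_add, psi_const_mul, psi_tsum, psi_const_mul]
  congr 1

theorem expectPsi_expTime_min [Countable S] {θ : ℝ} (hθ : 0 < θ) :
    M.expectPsi (fun ω => expTime θ (min (T ω) (τ ω))) = 1 + (ENNReal.ofReal (Real.exp θ) - 1) *
      M.psi (M.green (ENNReal.ofReal (Real.exp θ)) 1) := by
  have h : M.expectPsi (fun ω => expTime θ (min (T ω) (τ ω))) =
      M.psi fun x => M.expect x (fun ω => expTime θ (min (T ω) (τ ω))) := rfl
  have h1 := M.psi_one
  rw [h]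
  simp_rw [M.expect_expTime_min hθ, psi_add, psi_const_mul]
  congr 1

/-- At θ = 0 the weight is 1 even for infinite T. Hence θ > θ₁ forces θ > 0, where the series for
the exponential moments are valid. -/
theorem θ₁_nonneg : 0 ≤ M.θ₁ := by
  refine le_iSup₂_of_le (0 : ℝ) ?_ (by simp)
  simp [expTime_zero, expectPsi, expect, M.ψ.tsum_coe]

theorem exp_sub_one_pos {θ : ℝ} (hθ : 0 < θ) : 0 < ENNReal.ofReal (Real.exp θ) - 1 := by
  rw [tsub_pos_iff_lt, ← ENNReal.ofReal_one]
  exact (ENNReal.ofReal_lt_ofReal_iff (Real.exp_pos _)).2 (Real.one_lt_exp_iff.2 hθ)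

/-- Between `θ₁` and `θ₂` the cycles have finite weight at least one. -/
theorem one_le_of_mem_Ioo [Countable S] {θ : ℝ} (h1 : M.θ₁ < θ) (h2 : θ < M.θ₂) :
    M.psi (M.green (ENNReal.ofReal (Real.exp θ)) 1) ≠ ∞ ∧
      1 ≤ M.psi (M.colVec (ENNReal.ofReal (Real.exp θ))) := by
  have hθ : 0 < θ := by exact_mod_cast M.θ₁_nonneg.trans_lt h1
  have hfin : M.psi (M.green (ENNReal.ofReal (Real.exp θ)) 1) ≠ ∞ := by
    obtain ⟨θ', hlt⟩ := lt_iSup_iff.1 h2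
    obtain ⟨hp, hlt⟩ := lt_iSup_iff.1 hlt
    have hle : θ ≤ θ' := by exact_mod_cast hlt.le
    have hmono : M.expectPsi (fun ω => expTime θ (min (T ω) (τ ω))) ≤
        M.expectPsi (fun ω => expTime θ' (min (T ω) (τ ω))) :=
      M.psi_mono fun x => lintegral_mono fun ω => expTime_mono hle _
    intro hc
    rw [M.expectPsi_expTime_min hθ, hc, ENNReal.mul_top (exp_sub_one_pos hθ).ne', add_top] at hmono
    exact hmono.not_gt hp
  refine ⟨hfin, ?_⟩
  -- If F < 1, then E_ψ e^{θT} is finite and θ ≤ θ₁.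
  by_contra hc
  have := M.tsum_pow_mul_psi_Be_lt_top hfin (not_le.1 hc)
  refine h1.not_ge (le_iSup₂_of_le θ ?_ le_rfl)
  rw [M.expectPsi_expTime_T hθ]
  exact ENNReal.add_lt_top.2 ⟨ENNReal.one_lt_top,
    ENNReal.mul_lt_top (tsub_le_self.trans_lt ENNReal.ofReal_lt_top) this⟩

/-- The zeroth cycle weight is exactly rδ, and the others are monotone; this gives strict growth of
F. -/
theorem psi_colVec_add_le {r r' : ℝ≥0∞} (h : r ≤ r') :
    M.psi (M.colVec r) + (r' - r) * M.δ ≤ M.psi (M.colVec r') := by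
  simp_rw [psi_colVec_eq_tsum]
  rw [tsum_eq_zero_add' (f := fun n => M.cycleWeight r n) ENNReal.summable,
    tsum_eq_zero_add' (f := fun n => M.cycleWeight r' n) ENNReal.summable, add_right_comm]
  gcongr ?_ + ?_
  · simp only [cycleWeight, tabooMass_zero, zero_add, pow_one, mul_one]
    rw [← add_mul, add_tsub_cancel_of_le h]
  · refine ENNReal.tsum_le_tsum fun n => ?_
    unfold cycleWeight
    gcongr

theorem psi_colVec_lt {r r' : ℝ≥0∞} (h : r < r') (hr : M.psi (M.colVec r) ≠ ∞) :
    M.psi (M.colVec r) < M.psi (M.colVec r') :=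
  (ENNReal.lt_add_right hr (mul_ne_zero (tsub_pos_of_lt h).ne' M.δ_ne_zero)).trans_le
    (M.psi_colVec_add_le h.le)

theorem psi_colVec_mono {r r' : ℝ≥0∞} (h : r ≤ r') :
    M.psi (M.colVec r) ≤ M.psi (M.colVec r') :=
  le_self_add.trans (M.psi_colVec_add_le h)

theorem psi_colVec_ne_top {r : ℝ≥0∞} (hr : r ≠ ∞) (hk : M.psi (M.green r 1) ≠ ∞) :
    M.psi (M.colVec r) ≠ ∞ := by
  rw [psi_colVec]
  exact ENNReal.mul_ne_top (ENNReal.mul_ne_top hr ENNReal.coe_ne_top) hk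

theorem cycleWeight_ne_top {r : ℝ≥0∞} (hr : r ≠ ∞) (n : ℕ) : M.cycleWeight r n ≠ ∞ := by
  have : M.tabooMass n ≤ 1 := by
    rw [← psi_one M]
    exact M.psi_mono fun x => (M.iterate_Btilde_le n 1 x).trans (M.iterate_Be_one_le n x)
  exact ENNReal.mul_ne_top (ENNReal.pow_ne_top hr)
    (ENNReal.mul_ne_top ENNReal.coe_ne_top (this.trans_lt ENNReal.one_lt_top).ne)

/-- The power series F converges at R, so it is continuous on the closed interval [0, R] by the
Weierstrass test, and it climbs from 0 to at least 1. -/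
theorem exists_regen_eq_one {R : ℝ} (hR : 0 < R)
    (hk : M.psi (M.green (ENNReal.ofReal R) 1) ≠ ∞)
    (h1 : 1 ≤ M.psi (M.colVec (ENNReal.ofReal R))) :
    ∃ θ : ℝ, M.psi (M.colVec (ENNReal.ofReal (Real.exp θ))) = 1 := by
  have hF := M.psi_colVec_ne_top ENNReal.ofReal_ne_top hk
  let h : ℝ → ℝ := fun s => ∑' n, s ^ (n + 1) * (M.δ * M.tabooMass n).toReal
  have hterm (s : ℝ) (hs : 0 ≤ s) (n : ℕ) : (M.cycleWeight (ENNReal.ofReal s) n).toReal =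
      s ^ (n + 1) * (M.δ * M.tabooMass n).toReal := by
    rw [cycleWeight, ENNReal.toReal_mul, ENNReal.toReal_pow, ENNReal.toReal_ofReal hs]
  have hval (s : ℝ) (hs : 0 ≤ s) : h s = (M.psi (M.colVec (ENNReal.ofReal s))).toReal := by
    rw [psi_colVec_eq_tsum, ENNReal.tsum_toReal_eq
      (fun n => M.cycleWeight_ne_top ENNReal.ofReal_ne_top n)]
    exact tsum_congr fun n => (hterm s hs n).symm
  have hcont : ContinuousOn h (Set.Icc 0 R) := by
    refine continuousOn_tsum (u := fun n => (M.cycleWeight (ENNReal.ofReal R) n).toReal)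
      (fun n => by fun_prop) ?_ fun n s hs => ?_
    · refine ENNReal.summable_toReal ?_
      rwa [← psi_colVec_eq_tsum]
    · rw [hterm R hR.le, Real.norm_of_nonneg (mul_nonneg (pow_nonneg hs.1 _) ENNReal.toReal_nonneg)]
      exact mul_le_mul_of_nonneg_right (pow_le_pow_left₀ hs.1 hs.2 _) ENNReal.toReal_nonneg
  have h0 : h 0 = 0 := by simp [h]
  have hR1 : 1 ≤ h R := by
    rw [hval R hR.le, ← ENNReal.toReal_one]
    exact ENNReal.toReal_mono hF h1
  obtain ⟨s, hs, hs1⟩ := intermediate_value_Icc hR.le hcont (show (1 : ℝ) ∈ Set.Icc (h 0) (h R) from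
    ⟨by simp [h0], hR1⟩)
  have hs0 : 0 < s := by
    refine lt_of_le_of_ne hs.1 ?_
    rintro rfl
    rw [h0] at hs1
    exact zero_ne_one hs1
  refine ⟨Real.log s, ?_⟩
  rw [Real.exp_log hs0]
  rwa [hval s hs.1, ENNReal.toReal_eq_one_iff] at hs1

/-- For a < b between θ₁ and θ₂, F(e^b) > F(e^a) ≥ 1 by strict monotonicity, so a solution of F = 1
lies below b. -/
theorem exists_lt_psi_green_ne_top [Countable S] (hθ : M.θ₁ < M.θ₂) {θ : ℝ}
    (h1 : M.psi (M.colVec (ENNReal.ofReal (Real.exp θ))) = 1) :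
    ∃ θ', θ < θ' ∧ M.psi (M.green (ENNReal.ofReal (Real.exp θ')) 1) ≠ ∞ := by
  obtain ⟨a, ha1, ha2⟩ := EReal.exists_between_coe_real hθ
  obtain ⟨b, hb1, hb2⟩ := EReal.exists_between_coe_real ha2
  have hab : a < b := by exact_mod_cast hb1
  have ha := M.one_le_of_mem_Ioo ha1 ha2
  have hb := M.one_le_of_mem_Ioo (ha1.trans hb1) hb2
  refine ⟨b, ?_, hb.1⟩
  by_contra! hc
  have h2 := M.psi_colVec_mono (ENNReal.ofReal_le_ofReal (Real.exp_le_exp.2 hc))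
  have h3 := M.psi_colVec_lt ((ENNReal.ofReal_lt_ofReal_iff (Real.exp_pos _)).2
    (Real.exp_lt_exp.2 hab)) (M.psi_colVec_ne_top ENNReal.ofReal_ne_top ha.1)
  exact (ha.2.trans_lt (h3.trans_le h2)).ne h1.symm

/-- The weight of the cycles longer than `i`. -/
noncomputable def tailWeight (r : ℝ≥0∞) (i : ℕ) : ℝ≥0∞ := ∑' m, M.cycleWeight r (i + m)

/-- The powers of B̃ merge into the double series of rⁿ⁺ᵐ⁺¹ δ ψB̃ⁿ⁺ᵐ1. Its sum over tails is the
mean cycle length. -/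
theorem tsum_rowVec_mul_colVec (r : ℝ≥0∞) :
    ∑' w, M.rowVec r w * M.colVec r w = ∑' i, M.tailWeight r i := by
  rw [tsum_rowVec_mul, psi_green]
  refine tsum_congr fun n => ?_
  have : M.colVec r = fun x => ∑' m, (r * M.δ * r ^ m) * (colOp M.Btilde)^[m] 1 x := by
    ext x
    rw [colVec, green, ← ENNReal.tsum_mul_left]
    exact tsum_congr fun m => by ring
  rw [this, colOp_iterate_tsum, psi_tsum, ← ENNReal.tsum_mul_left]
  refine tsum_congr fun m => ?_
  rw [colOp_iterate_const_mul, psi_const_mul, ← Function.iterate_add_apply, cycleWeight, tabooMass]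
  ring

/-- Comparison with the larger parameter R bounds the i-th tail by (r / R)ⁱ F(R). -/
theorem tsum_tailWeight_lt_top {r R : ℝ≥0∞} (hr : r < R) (hR : R ≠ ∞)
    (hk : M.psi (M.green R 1) ≠ ∞) : ∑' i, M.tailWeight r i < ∞ := by
  have hR0 : R ≠ 0 := (bot_le.trans_lt hr).ne'
  have hq : r / R < 1 := (ENNReal.div_lt_iff (Or.inl hR0) (Or.inl hR)).2 (by simpa using hr)
  have hcw (n : ℕ) : M.cycleWeight r n = (r / R) ^ (n + 1) * M.cycleWeight R n := by
    rw [cycleWeight, cycleWeight, ← mul_assoc ((r / R) ^ (n + 1)), ← mul_pow, ENNReal.div_mul_cancel hR0 hR]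
  have htail (i : ℕ) : M.tailWeight r i ≤ (r / R) ^ i * M.psi (M.colVec R) := by
    rw [psi_colVec_eq_tsum, tailWeight]
    calc ∑' m, M.cycleWeight r (i + m) ≤ ∑' m, (r / R) ^ i * M.cycleWeight R (i + m) := by
          refine ENNReal.tsum_le_tsum fun m => ?_
          rw [hcw]
          gcongr ?_ * _
          exact pow_le_pow_right_of_le_one' hq.le (by omega)
      _ = (r / R) ^ i * ∑' m, M.cycleWeight R (i + m) := ENNReal.tsum_mul_left
      _ ≤ _ := by
          refine mul_le_mul' le_rfl ?_
          exact ENNReal.tsum_comp_le_tsum_of_injective (add_right_injective i) _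
  refine (ENNReal.tsum_le_tsum htail).trans_lt ?_
  rw [ENNReal.tsum_mul_right, ENNReal.tsum_geometric]
  exact ENNReal.mul_lt_top (by simpa using hq) (M.psi_colVec_ne_top hR hk).lt_top

end SplitMatrix

/-! ### Aperiodicity and convergence of the powers -/

theorem ENNReal.hasSum_toReal_tsum {ι : Type*} {f : ι → ℝ≥0∞} (hf : ∑' i, f i ≠ ∞) :
    HasSum (fun i => (f i).toReal) (∑' i, f i).toReal := by
  rw [ENNReal.tsum_toReal_eq (ENNReal.ne_top_of_tsum_ne_top hf)]
  exact ENNReal.hasSum_toReal hf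

theorem matPow_eq_iterate {S : Type*} (B : S → S → ℝ≥0) (n : ℕ) (x y : S) :
    matPow B n x y = (colOp fun x y => (B x y : ℝ≥0∞))^[n] (({y} : Set S).indicator 1) x := by
  induction n generalizing x with
  | zero =>
    by_cases h : x = y
    · simp [matPow, h]
    · simp [matPow, h, Ne.symm h]
  | succ n ih =>
    rw [Function.iterate_succ_apply', matPow, colOp]
    exact tsum_congr fun w => by rw [ih]

theorem matPow_succ_pos {S : Type*} {B : S → S → ℝ≥0} {n : ℕ} {x w y : S} (h : B x w ≠ 0)
    (h' : 0 < matPow B n w y) : 0 < matPow B (n + 1) x y := by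
  have : (B x w : ℝ≥0∞) * matPow B n w y ≤ matPow B (n + 1) x y := ENNReal.le_tsum w
  exact (ENNReal.mul_pos (by exact_mod_cast h) h'.ne').trans_le this

theorem exists_matPow_pos {S : Type*} {B : S → S → ℝ≥0}
    (hirr : Matrix.IsIrreducible (Matrix.of fun x y : S => (B x y : ℝ))) (x y : S) :
    ∃ n, 0 < matPow B n x y := by
  -- Paths grow on the right while `matPow` unfolds on the left, so the induction carries an
  -- arbitrary continuation from y.
  have key : ∀ y, ∃ n, ∀ z m, 0 < matPow B m y z → 0 < matPow B (m + n) x z := by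
    refine hirr.induction (x := x) ⟨0, fun z m h => h⟩ ?_
    rintro y y' ⟨n, hn⟩ hB
    refine ⟨n + 1, fun z m h => ?_⟩
    rw [add_comm n, ← add_assoc]
    exact hn z (m + 1) (matPow_succ_pos hB h)
  obtain ⟨n, hn⟩ := key y
  exact ⟨_, hn y 0 (by simp [matPow])⟩

namespace SplitMatrix

open SplitPath Filter

variable {S : Type*} (M : SplitMatrix S)

/-- An irreducible matrix with a uniform minorization is aperiodic. -/
theorem matPeriod_eq_one (hirr : Matrix.IsIrreducible (Matrix.of fun x y : S => (M.B x y : ℝ)))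
    (z : S) : matPeriod M.B z = 1 := by
  obtain ⟨w, hw⟩ := M.exists_ψ_pos
  obtain ⟨n, hn⟩ := exists_matPow_pos hirr w z
  -- The return from z through w takes n + 1 steps; inserting the loop at w gives n + 2. A common
  -- divisor divides their difference 1.
  have h1 := matPow_succ_pos (M.B_ne_zero_of_ψ (x := z) hw) hn
  have h2 := matPow_succ_pos (M.B_ne_zero_of_ψ (x := z) hw)
    (matPow_succ_pos (M.B_ne_zero_of_ψ (x := w) hw) hn)
  have : {d : ℕ | ∀ k : ℕ, 1 ≤ k → 0 < matPow M.B k z z → d ∣ k} = {1} := by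
    ext d
    simp only [Set.mem_ofPred_eq, Set.mem_singleton_iff]
    constructor
    · intro h
      have h3 := (Nat.dvd_add_right (h _ (by omega) h1)).1 (h _ (by omega) h2)
      exact Nat.dvd_one.1 h3
    · rintro rfl k _ _
      exact one_dvd k
  rw [matPeriod, this, csSup_singleton]

section limit

variable {M} {r : ℝ≥0∞} (hr0 : r ≠ 0) (hr : r ≠ ∞) (h1 : M.psi (M.colVec r) = 1)

include hr0 hr h1

/-- Decomposing at the first regeneration gives a renewal equation with the cycle weights as
increments. Its forcing terms sum to `rowVec` at y, and the mean increment is the sum of the tails.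
-/
theorem tendsto_psi_iterate_Be (hμ : ∑' i, M.tailWeight r i ≠ ∞) (y : S) :
    Tendsto (fun n => (r ^ n * M.psi ((colOp M.Be)^[n] (({y} : Set S).indicator 1))).toReal) atTop
      (𝓝 ((M.rowVec r y).toReal / (∑' i, M.tailWeight r i).toReal)) := by
  set v : S → ℝ≥0∞ := ({y} : Set S).indicator 1
  have hv1 (x : S) : v x ≤ 1 := Set.indicator_le_self' (by simp) x
  have hcw (i : ℕ) : M.cycleWeight r i ≠ ∞ := M.cycleWeight_ne_top hr i
  have htail (i : ℕ) : M.tailWeight r i ≠ ∞ := ENNReal.ne_top_of_tsum_ne_top hμ i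
  have hb_top (n : ℕ) : r ^ n * M.psi ((colOp M.Be)^[n] v) ≠ ∞ := by
    refine ENNReal.mul_ne_top (ENNReal.pow_ne_top hr) (ne_top_of_le_ne_top ENNReal.one_ne_top ?_)
    rw [← M.psi_one]
    exact M.psi_mono fun x => (colOp_iterate_mono _ n hv1 x).trans (M.iterate_Be_one_le n x)
  have ha_top (n : ℕ) : r ^ n * M.psi ((colOp M.Btilde)^[n] v) ≠ ∞ := by
    refine ne_top_of_le_ne_top (hb_top n) ?_
    rw [pow_mul_psi_iterate_Be]
    exact le_self_add
  have hrow : M.rowVec r y = ∑' n, r ^ n * M.psi ((colOp M.Btilde)^[n] v) := psi_green ..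
  have ha : HasSum (fun n => (r ^ n * M.psi ((colOp M.Btilde)^[n] v)).toReal)
      (M.rowVec r y).toReal := by
    rw [hrow]
    refine ENNReal.hasSum_toReal_tsum ?_
    rw [← hrow]
    exact (rowVec_lt_top hr0 h1 y).ne
  have hb (n : ℕ) : (r ^ n * M.psi ((colOp M.Be)^[n] v)).toReal =
      (r ^ n * M.psi ((colOp M.Btilde)^[n] v)).toReal + ∑ i ∈ Finset.range n,
        (M.cycleWeight r i).toReal *
          (r ^ (n - 1 - i) * M.psi ((colOp M.Be)^[n - 1 - i] v)).toReal := by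
    rw [pow_mul_psi_iterate_Be, ENNReal.toReal_add (ha_top n), ENNReal.toReal_sum]
    · simp_rw [ENNReal.toReal_mul]
    · exact fun i _ => ENNReal.mul_ne_top (hcw i) (hb_top _)
    · exact ENNReal.sum_ne_top.2 fun i _ => ENNReal.mul_ne_top (hcw i) (hb_top _)
  have hq0 : M.tailWeight r 0 = 1 := by
    rw [tailWeight, ← h1, psi_colVec_eq_tsum]
    simp_rw [zero_add]
  have hq (i : ℕ) : (M.tailWeight r i).toReal =
      (M.cycleWeight r i).toReal + (M.tailWeight r (i + 1)).toReal := by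
    rw [← ENNReal.toReal_add (hcw i) (htail _), tailWeight,
      tsum_eq_zero_add' ENNReal.summable, tailWeight, add_zero]
    simp_rw [add_assoc, add_comm]
  have hqnn (i : ℕ) : 0 ≤ (M.tailWeight r i).toReal := ENNReal.toReal_nonneg
  have hf1 : HasSum (fun i => (M.cycleWeight r i).toReal) 1 := by
    have := ENNReal.hasSum_toReal_tsum (f := fun i => M.cycleWeight r i)
      (by rw [← psi_colVec_eq_tsum, h1]; exact ENNReal.one_ne_top)
    rwa [← psi_colVec_eq_tsum, h1, ENNReal.toReal_one] at this
  refine renewal_tendsto (f := fun i => (M.cycleWeight r i).toReal)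
    (q := fun i => (M.tailWeight r i).toReal) (C := (M.rowVec r y).toReal) ?_
    (fun i => ENNReal.toReal_nonneg) hf1 (by simp [hq0]) hq hqnn (ENNReal.hasSum_toReal_tsum hμ)
    ha (fun n => ?_) hb
  · refine ENNReal.toReal_pos ?_ (hcw 0)
    simp [cycleWeight, tabooMass_zero, hr0, M.δ_ne_zero]
  -- Boundedness comes from the conserved sum: its i = 0 term, with q 0 = 1, is at most the total
  -- forcing.
  · rw [abs_of_nonneg ENNReal.toReal_nonneg]
    have h2 := renewal_sum_tail (q := fun i => (M.tailWeight r i).toReal)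
      (f := fun i => (M.cycleWeight r i).toReal) (by simp [hq0]) hq hb n
    have h3 := Finset.single_le_sum (s := Finset.range (n + 1))
      (f := fun i => (M.tailWeight r i).toReal *
        (r ^ (n - i) * M.psi ((colOp M.Be)^[n - i] v)).toReal)
      (fun i _ => mul_nonneg (hqnn i) ENNReal.toReal_nonneg)
      (Finset.mem_range.2 (Nat.succ_pos n))
    simp only [hq0, ENNReal.toReal_one, one_mul, Nat.sub_zero] at h3
    exact (h3.trans h2.le).trans (sum_le_hasSum _ (fun i _ => ENNReal.toReal_nonneg) ha)

/-- The first regeneration from x has weights of total `colVec` at x, convolved with a convergent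
sequence. The part without regeneration is a term of a convergent series and vanishes. -/
theorem tendsto_iterate_Be (hμ : ∑' i, M.tailWeight r i ≠ ∞)
    (hirr : Matrix.IsIrreducible (Matrix.of fun x y : S => (M.B x y : ℝ))) (x y : S) :
    Tendsto (fun n => r ^ n * (colOp M.Be)^[n] (({y} : Set S).indicator 1) x) atTop
      (𝓝 (M.colVec r x * M.rowVec r y / ∑' i, M.tailWeight r i)) := by
  have hlim := tendsto_psi_iterate_Be hr0 hr h1 hμ y
  set v : S → ℝ≥0∞ := ({y} : Set S).indicator 1
  have hv1 (x : S) : v x ≤ 1 := Set.indicator_le_self' (by simp) x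
  have hcol := colVec_lt_top hr0 hr h1 hirr x
  have hμ0 : ∑' i, M.tailWeight r i ≠ 0 := by
    have hq0 : M.tailWeight r 0 = 1 := by
      rw [tailWeight, ← h1, psi_colVec_eq_tsum]
      simp_rw [zero_add]
    intro h0
    rw [ENNReal.tsum_eq_zero.1 h0 0] at hq0
    exact zero_ne_one hq0
  have hB_top (n : ℕ) : r ^ n * (colOp M.Be)^[n] v x ≠ ∞ :=
    ENNReal.mul_ne_top (ENNReal.pow_ne_top hr) (ne_top_of_le_ne_top ENNReal.one_ne_top
      ((colOp_iterate_mono _ n hv1 x).trans (M.iterate_Be_one_le n x)))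
  have hb_top (n : ℕ) : r ^ n * M.psi ((colOp M.Be)^[n] v) ≠ ∞ := by
    refine ENNReal.mul_ne_top (ENNReal.pow_ne_top hr) (ne_top_of_le_ne_top ENNReal.one_ne_top ?_)
    rw [← M.psi_one]
    exact M.psi_mono fun x => (colOp_iterate_mono _ n hv1 x).trans (M.iterate_Be_one_le n x)
  have hK_top (n : ℕ) : r ^ n * (colOp M.Btilde)^[n] v x ≠ ∞ := by
    refine ne_top_of_le_ne_top (hB_top n) ?_
    gcongr
    exact M.iterate_Btilde_le n v x
  have hgreen : M.green r 1 x ≠ ∞ := by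
    intro hc
    rw [colVec, hc, ENNReal.mul_top (mul_ne_zero hr0 M.δ_ne_zero)] at hcol
    exact hcol.ne rfl
  have hc_sum : ∑' i, r * M.δ * (r ^ i * (colOp M.Btilde)^[i] 1 x) = M.colVec r x := by
    rw [ENNReal.tsum_mul_left]
    rfl
  have hc_top (i : ℕ) : r * M.δ * (r ^ i * (colOp M.Btilde)^[i] 1 x) ≠ ∞ :=
    ENNReal.ne_top_of_tsum_ne_top (by rw [hc_sum]; exact hcol.ne) i
  have hK0 : Tendsto (fun n => (r ^ n * (colOp M.Btilde)^[n] v x).toReal) atTop (𝓝 0) := by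
    refine (ENNReal.summable_toReal (ne_top_of_le_ne_top hgreen ?_)).tendsto_atTop_zero
    refine ENNReal.tsum_le_tsum fun n => ?_
    gcongr
    exact colOp_iterate_mono _ n hv1 x
  obtain ⟨C, hC⟩ := hlim.abs.bddAbove_range
  have hC' (n : ℕ) : |(r ^ n * M.psi ((colOp M.Be)^[n] v)).toReal| ≤ C :=
    hC ⟨n, rfl⟩
  have hconv := tendsto_sum_mul_shift (l := atTop) (N := fun n => n - 1)
    (tendsto_sub_atTop_nat 1)
    (c := fun i => (r * M.δ * (r ^ i * (colOp M.Btilde)^[i] 1 x)).toReal)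
    (b := fun n => (r ^ n * M.psi ((colOp M.Be)^[n] v)).toReal)
    (ℓ := fun _ => (M.rowVec r y).toReal / (∑' i, M.tailWeight r i).toReal)
    (by
      simp_rw [abs_of_nonneg ENNReal.toReal_nonneg]
      exact ENNReal.summable_toReal (by rw [hc_sum]; exact hcol.ne))
    hC' (fun i => hlim.comp ((tendsto_sub_atTop_nat i).comp (tendsto_sub_atTop_nat 1)))
  rw [tsum_mul_right, ← ENNReal.tsum_toReal_eq hc_top, hc_sum] at hconv
  have hsum := hK0.add hconv
  rw [zero_add, ← mul_div_assoc, ← ENNReal.toReal_mul, ← ENNReal.toReal_div] at hsum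
  rw [← ENNReal.tendsto_toReal_iff hB_top]
  · refine hsum.congr' ?_
    filter_upwards [eventually_ge_atTop 1] with n hn
    rw [pow_mul_iterate_Be, ENNReal.toReal_add (hK_top n), ENNReal.toReal_sum,
      Nat.sub_add_cancel hn]
    · simp_rw [ENNReal.toReal_mul]
    · exact fun i _ => ENNReal.mul_ne_top (hc_top i) (hb_top _)
    · exact ENNReal.sum_ne_top.2 fun i _ => ENNReal.mul_ne_top (hc_top i) (hb_top _)
  · exact (ENNReal.div_lt_top (ENNReal.mul_ne_top hcol.ne (rowVec_lt_top hr0 h1 y).ne) hμ0).ne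

end limit

end SplitMatrix

/-! ### The main theorem -/

theorem theorem4 {S : Type*} [Countable S] (M : SplitMatrix S)
    (hirr : Matrix.IsIrreducible (Matrix.of fun x y : S => (M.B x y : ℝ)))
    (hθ : M.θ₁ < M.θ₂) :
    (∃ θ : ℝ, M.expectPsi (SplitMatrix.regenWeight θ) = 1) ∧
    ∀ θ : ℝ, M.expectPsi (SplitMatrix.regenWeight θ) = 1 →
      -- (i) the column eigenvector
      ((∀ x, 0 < M.uStar θ x ∧ M.uStar θ x < ∞) ∧
        (∀ x, ∑' y, (M.B x y : ℝ≥0∞) * M.uStar θ y = SplitMatrix.lamStar θ * M.uStar θ x) ∧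
        (∀ u : S → ℝ≥0, (∀ x, 0 < u x) →
          (∀ x, ∑' y, (M.B x y : ℝ≥0∞) * u y = SplitMatrix.lamStar θ * u x) →
          ∃ c : ℝ≥0, 0 < c ∧ ∀ x, (u x : ℝ≥0∞) = c * M.uStar θ x)) ∧
      -- (ii) the row eigenvector
      ((∀ y, 0 < M.ηStar θ y ∧ M.ηStar θ y < ∞) ∧
        (∀ y, ∑' x, M.ηStar θ x * (M.B x y : ℝ≥0∞) = SplitMatrix.lamStar θ * M.ηStar θ y) ∧
        (∀ η : S → ℝ≥0, (∀ y, 0 < η y) →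
          (∀ y, ∑' x, (η x : ℝ≥0∞) * (M.B x y : ℝ≥0∞) = SplitMatrix.lamStar θ * η y) →
          ∃ c : ℝ≥0, 0 < c ∧ ∀ y, (η y : ℝ≥0∞) = c * M.ηStar θ y)) ∧
      -- (iii) summability
      ∑' w, M.ηStar θ w * M.uStar θ w < ∞ ∧
      -- (iv) convergence of the averages over one period `p` of `B`
      (∀ z x y : S, Filter.Tendsto
        (fun n : ℕ => (matPeriod M.B z : ℝ≥0∞)⁻¹ *
          ∑ j ∈ Finset.range (matPeriod M.B z),
            ((SplitMatrix.lamStar θ)⁻¹) ^ (matPeriod M.B z * n + j) *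
              matPow M.B (matPeriod M.B z * n + j) x y)
        Filter.atTop
        (𝓝 (M.uStar θ x * M.ηStar θ y / ∑' w, M.ηStar θ w * M.uStar θ w))) := by
  refine ⟨?_, fun θ h1 => ?_⟩
  · obtain ⟨a, ha1, ha2⟩ := EReal.exists_between_coe_real hθ
    obtain ⟨hfin, hge⟩ := M.one_le_of_mem_Ioo ha1 ha2
    obtain ⟨θ, hθ'⟩ := M.exists_regen_eq_one (Real.exp_pos a) hfin hge
    exact ⟨θ, by rw [M.expectPsi_regenWeight, hθ']⟩
  · rw [M.expectPsi_regenWeight] at h1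
    obtain ⟨θ', hlt, hfin⟩ := M.exists_lt_psi_green_ne_top hθ h1
    have hlt' : ENNReal.ofReal (Real.exp θ) < ENNReal.ofReal (Real.exp θ') :=
      (ENNReal.ofReal_lt_ofReal_iff (Real.exp_pos _)).2 (Real.exp_lt_exp.2 hlt)
    have hμ := M.tsum_tailWeight_lt_top hlt' ENNReal.ofReal_ne_top hfin
    have hlam : SplitMatrix.lamStar θ = (ENNReal.ofReal (Real.exp θ))⁻¹ := by
      rw [SplitMatrix.lamStar, Real.exp_neg, ENNReal.ofReal_inv_of_pos (Real.exp_pos θ)]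
    have hr0 : ENNReal.ofReal (Real.exp θ) ≠ 0 := by simp [Real.exp_pos]
    have hr : ENNReal.ofReal (Real.exp θ) ≠ ∞ := ENNReal.ofReal_ne_top
    rw [M.uStar_eq_colVec, M.ηStar_eq_rowVec, hlam, inv_inv, M.tsum_rowVec_mul_colVec]
    set r := ENNReal.ofReal (Real.exp θ)
    refine ⟨⟨fun x => ⟨SplitMatrix.colVec_pos hr0 x, SplitMatrix.colVec_lt_top hr0 hr h1 hirr x⟩,
      SplitMatrix.colOp_Be_colVec hr0 hr h1, fun u hpos hu =>
        SplitMatrix.eq_mul_colVec hr0 hr h1 hirr hpos hu⟩,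
      ⟨fun y => ⟨SplitMatrix.rowVec_pos hr0 hr h1 hirr y, SplitMatrix.rowVec_lt_top hr0 h1 y⟩,
        SplitMatrix.tsum_rowVec_mul_Be hr0 hr h1, fun η hpos hη =>
          SplitMatrix.eq_mul_rowVec hr0 hr h1 hpos hη⟩, hμ, fun z x y => ?_⟩
    have hlim := SplitMatrix.tendsto_iterate_Be hr0 hr h1 hμ.ne hirr x y
    simp only [M.matPeriod_eq_one hirr z, Nat.cast_one, inv_one, one_mul, Finset.sum_range_one,
      add_zero, matPow_eq_iterate]
    exact hlim
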